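/- Let $\mathcal{X}$ be a set, let $\mathcal{Y}$ be a countable (finite or countably infinite) set, and let $\mathcal{R}:\mathcal{X}\to\mathcal{Y}$ be a randomized map that is $\epsilon_0$-LDP with $\epsilon_0\ge 0$, i.e. $\Pr[\mathcal{R}(d)\in S]\le e^{\epsilon_0}\Pr[\mathcal{R}(d')\in S]$ for all $d,d'\in\mathcal{X}$ and $S\subseteq\mathcal{Y}$. For integers $1\le k\le n$, the subsampled shuffle mechanism $\mathcal{M}$ takes a dataset $D=(d_1,\dots,d_n)\in\mathcal{X}^n$, draws $\mathcal{R}(d_1),\dots,\mathcal{R}(d_n)$ independently, selects a uniformly random $k$-element subset of these $n$ messages (sampling without replacement), and outputs the selected $k$ messages in a uniformly random order. For an integer $\lambda\ge 2$ let $$\epsilon(\lambda)=\sup_{D,D'}\ \frac{1}{\lambda-1}\log\sum_{y\in\mathcal{Y}^k}\Pr[\mathcal{M}(D)=y]^{\lambda}\,\Pr[\mathcal{M}(D')=y]^{1-\lambda}$$ be its Rényi differential privacy of order $\lambda$, the supremum being over all $D,D'\in\mathcal{X}^n$ that differ in at most one entry (terms with $\Pr[\mathcal{M}(D)=y]=0$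 are $0$; terms with $\Pr[\mathcal{M}(D')=y]=0<\Pr[\mathcal{M}(D)=y]$ are $+\infty$). Then for all integers $1\le k\le n$, every $\epsilon_0\ge 0$, every $\epsilon_0$-LDP randomizer $\mathcal{R}$ as above and every integer $\lambda\ge 2$, $$\epsilon(\lambda)\le\frac{1}{\lambda-1}\log\left(1+4\binom{\lambda}{2}\gamma^{2}\frac{(e^{\epsilon_0}-1)^2}{\overline{k}e^{\epsilon_0}}+\sum_{j=3}^{\lambda}\binom{\lambda}{j}\gamma^{j}\,j\,\Gamma(j/2)\left(\frac{2(e^{2\epsilon_0}-1)^2}{\overline{k}e^{2\epsilon_0}}\right)^{j/2}+\Upsilon\right),$$ where $\gamma=\frac{k}{n}$, $\overline{k}=\left\lfloor\frac{k-1}{2e^{\epsilon_0}}\right\rfloor+1$, $\Gamma(z)=\int_0^\infty x^{z-1}e^{-x}\,dx$ is the Gamma function, and $$\Upsilon=\left(\left(1+\gamma\frac{e^{2\epsilon_0}-1}{e^{\epsilon_0}}\right)^{\lambda}-1-\lambda\gamma\frac{e^{2\epsilon_0}-1}{e^{\epsilon_0}}\right)e^{-\frac{k-1}{8e^{\epsilon_0}}}.$$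 -/

import Mathlib

open scoped ENNReal

noncomputable section

/-- A randomizer `R` with input space `X` and discrete range `Y` is `ε₀`-locally differentially
private: `Pr[R(d) ∈ S] ≤ e^{ε₀} Pr[R(d') ∈ S]` for all inputs `d`, `d'` and all events `S ⊆ Y`. -/
def IsLDP {X Y : Type*} (ε₀ : ℝ) (R : X → PMF Y) : Prop :=
  ∀ (d d' : X) (S : Set Y),
    (R d).toOuterMeasure S ≤ ENNReal.ofReal (Real.exp ε₀) * (R d').toOuterMeasure S

theorem tsum_prod_pmf {Y : Type*} :
    ∀ {n : ℕ} (p : Fin n → PMF Y), ∑' y : Fin n → Y, ∏ i, p i (y i) = 1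
  | 0, p => by simp
  | n + 1, p => by
    rw [← (Fin.consEquiv (fun _ : Fin (n + 1) => Y)).tsum_eq]
    simp only [Fin.consEquiv_apply, Fin.prod_univ_succ, Fin.cons_zero, Fin.cons_succ]
    rw [ENNReal.tsum_prod']
    simp only [ENNReal.tsum_mul_left]
    rw [tsum_prod_pmf (fun i => p i.succ)]
    simp [PMF.tsum_coe]

/-- The joint law of independent random variables `Y₁, …, Yₙ` with laws `p₁, …, pₙ`. -/
def indepPMF {Y : Type*} {n : ℕ} (p : Fin n → PMF Y) : PMF (Fin n → Y) :=
  ⟨fun y => ∏ i, p i (y i), ENNReal.summable.hasSum_iff.2 (tsum_prod_pmf p)⟩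

theorem nonempty_ksubset {n k : ℕ} (hk : k ≤ n) :
    Nonempty {S : Finset (Fin n) // S.card = k} := by
  obtain ⟨S, -, hS⟩ := Finset.exists_subset_card_eq
    (s := (Finset.univ : Finset (Fin n))) (n := k) (by simpa using hk)
  exact ⟨⟨S, hS⟩⟩

/-- Sampling without replacement: pick a uniformly random `k`-element subset of the `n` positions
and keep the entries of `y` at these positions (in increasing order of position). -/
def samp {Y : Type*} {n k : ℕ} (hk : k ≤ n) (y : Fin n → Y) : PMF (Fin k → Y) :=
  haveI := nonempty_ksubset hk
  (PMF.uniformOfFintype {S : Finset (Fin n) // S.card = k}).map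
    (fun S => fun j => y (S.1.orderEmbOfFin S.2 j))

/-- The shuffler: output a uniformly random permutation of the `k` inputs. -/
def shuffle {Y : Type*} {k : ℕ} (y : Fin k → Y) : PMF (Fin k → Y) :=
  (PMF.uniformOfFintype (Equiv.Perm (Fin k))).map (fun σ => y ∘ σ)

/-- The subsampled shuffle mechanism: on the dataset `D = (d₁, …, dₙ)`, apply the local randomizer
`R` independently to each `dᵢ`, sample `k` of the `n` messages without replacement, and shuffle
the sampled messages. -/
def subsampledShuffle {X Y : Type*} {n k : ℕ} (R : X → PMF Y) (hk : k ≤ n) (D : Fin n → X) :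
    PMF (Fin k → Y) :=
  ((indepPMF fun i => R (D i)).bind (samp hk)).bind shuffle

/-- Two datasets of `n` points are neighboring if they differ in (at most) one entry. -/
def Neighboring {X : Type*} {n : ℕ} (D D' : Fin n → X) : Prop :=
  ∃ i, ∀ j, j ≠ i → D j = D' j

/-- The Rényi divergence of order `α > 1`, `(α - 1)⁻¹ log ∑ P(z)^α Q(z)^(1-α)`, of two discrete
distributions. It is `⊤` if `P` is not absolutely continuous with respect to `Q`; terms with
`P z = 0` contribute `0`. -/
def renyiDiv {Z : Type*} (α : ℝ) (P Q : PMF Z) : EReal :=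
  (((α - 1)⁻¹ : ℝ) : EReal) * ENNReal.log (∑' z, P z ^ α * Q z ^ (1 - α))

/-- The Rényi differential privacy `ε(α)` of order `α` of a mechanism `M` on datasets of `n`
points: the supremum over neighboring datasets of the Rényi divergence of the output laws. -/
def rdp {X Z : Type*} {n : ℕ} (M : (Fin n → X) → PMF Z) (α : ℝ) : EReal :=
  ⨆ (D : Fin n → X) (D' : Fin n → X) (_ : Neighboring D D'), renyiDiv α (M D) (M D')

end

/-!
Write `a = exp ε₀`, `B = a - a⁻¹`, and let `D`, `D'` differ only in the entry of user `i`.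

**Mixture form.** The mechanism assigns messages to output slots by a uniformly random permutation
`π` of the users and keeps the first `k` slots (`subsampledShuffle_apply_toReal`). A permutation
that leaves user `i` out of the kept slots is obtained from one that puts `i` in a kept slot `b` by
exchanging the contents of `b` and of a discarded slot. So one may always put `i` in a kept slot
`b`, provided the message there is drawn from the mixture `refLaw`, which is `R (D' i)` with
probability `γ = k / n` and otherwise the message of a random discarded user
(`card_mul_sum_perm_prod_update`). The difference of the output laws on `D` and `D'` only involves
permutations that keep `i`, and equals `γ` times the same mixture weighted by the relative
difference `relDiff` of `R (D i)` and `R (D' i)` with respect to `refLaw`, evaluated at slot `b`.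

**Clones.** Let `P` and `Q` be the output laws on `D` and `D'`. By local privacy every message has
law `a⁻¹ • refLaw + (1 - a⁻¹) • (residual law)`. Condition on the set `A ∋ b` of slots that use the
first component. The slots of `A` are exchangeable and `refLaw` does not depend on the order of the
kept slots, so the weight at `b` may be replaced by its average over `A`
(`sum_perm_eq_sum_perm_average`). This expresses `Q` as a finite mixture `∑ c ν`, and `P - Q` as
`γ ∑ c ν W`, where under `ν` the score `W` is an average of `|A|` independent centred variables
bounded by `B`.

**Moments.** Now `(P - Q) / Q` is `γ` times a conditional mean of `W`, so the binomial expansion of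
`(1 + (P - Q) / Q) ^ lam` and Jensen's inequality bound the Rényi sum by the absolute moments of
`W` (`tsum_pow_mul_pow_one_sub_le`). The second moment is at most `4 (a - 1)² / (a |A|)`; the
higher ones are bounded by integrating Hoeffding's tail bound, which yields the Gamma function.
These bounds are used when `|A| ≥ kbar`. Since `|A| - 1` is binomial with mean `(k - 1) / a`,
Chernoff's bound (`sum_powerset_card_le_half_mean`) shows that this fails with probability at most
`exp (-(k - 1) / (8 a))`, and then `|W| ≤ B` contributes the term `Υ`.
-/

/-! ### Moments of averages of independent variables -/

section Moments

open MeasureTheory ProbabilityTheory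

theorem PMF.hasSum_toReal {Z : Type*} (p : PMF Z) : HasSum (fun z => (p z).toReal) 1 := by
  have h := ENNReal.hasSum_toReal (f := p) (by simp [p.tsum_coe])
  rwa [← ENNReal.tsum_toReal_eq (fun z => p.apply_ne_top z), p.tsum_coe, ENNReal.toReal_one] at h

theorem PMF.summable_toReal_mul {Z : Type*} (p : PMF Z) {f : Z → ℝ} {C : ℝ}
    (hf : ∀ z, |f z| ≤ C) : Summable (fun z => (p z).toReal * f z) := by
  refine Summable.of_norm_bounded (p.hasSum_toReal.summable.mul_right C) fun z => ?_
  rw [norm_mul, Real.norm_of_nonneg ENNReal.toReal_nonneg]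
  exact mul_le_mul_of_nonneg_left (hf z) ENNReal.toReal_nonneg

theorem PMF.tsum_toReal_mul_eq_integral {Z : Type*} [Countable Z] [MeasurableSpace Z]
    [DiscreteMeasurableSpace Z] (p : PMF Z) {f : Z → ℝ} {C : ℝ} (hf : ∀ z, |f z| ≤ C) :
    ∑' z, (p z).toReal * f z = ∫ z, f z ∂p.toMeasure := by
  rw [PMF.integral_eq_tsum]
  · rfl
  · exact Integrable.of_bound (Measurable.of_discrete.aestronglyMeasurable) C (ae_of_all _ hf)

theorem indepPMF_toMeasure {Y : Type*} [Countable Y] [MeasurableSpace Y]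
    [DiscreteMeasurableSpace Y] {n : ℕ} (p : Fin n → PMF Y) :
    (indepPMF p).toMeasure = Measure.pi fun i => (p i).toMeasure := by
  refine Measure.ext_of_singleton fun y => ?_
  rw [Measure.pi_singleton, PMF.toMeasure_apply_singleton _ _ (MeasurableSet.singleton y)]
  simp only [PMF.toMeasure_apply_singleton _ _ (MeasurableSet.singleton _)]
  rfl

/-- Absolute moments of a sub-Gaussian variable, by integrating the two-sided Chernoff tail
`2 exp (-t² / (2c))` in the layer-cake formula. -/
theorem ProbabilityTheory.HasSubgaussianMGF.lintegral_abs_pow_le {Ω : Type*} [MeasurableSpace Ω]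
    {μ : Measure Ω} [IsProbabilityMeasure μ] {S : Ω → ℝ} {c : NNReal}
    (hS : HasSubgaussianMGF S c μ) {j : ℕ} (hj : 0 < j) :
    ∫⁻ ω, ENNReal.ofReal (|S ω| ^ j) ∂μ ≤
      ENNReal.ofReal (j * Real.Gamma ((j : ℝ) / 2) * (2 * (c : ℝ)) ^ ((j : ℝ) / 2)) := by
  have hj' : (0 : ℝ) < j := by exact_mod_cast hj
  rcases eq_or_ne c 0 with rfl | hc
  · have h0 := hS.ae_eq_zero_of_hasSubgaussianMGF_zero
    rw [lintegral_congr_ae (g := fun _ => 0)]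
    · simp
    · filter_upwards [h0] with ω hω
      simp [hω, hj.ne']
  have hc' : (0 : ℝ) < c := by positivity
  have h1 := lintegral_rpow_eq_lintegral_meas_le_mul μ (f := fun ω => |S ω|)
    (ae_of_all _ fun _ => abs_nonneg _) hS.aemeasurable.abs hj'
  simp only [Real.rpow_natCast] at h1
  rw [h1]
  have tail : ∀ t : ℝ, 0 < t → μ {ω | t ≤ |S ω|} ≤
      ENNReal.ofReal (2 * Real.exp (-(1 / (2 * c)) * t ^ (2 : ℝ))) := by
    intro t ht
    have e1 := hS.measure_ge_le ht.le
    have e2 := hS.neg.measure_ge_le ht.le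
    have hsub : {ω | t ≤ |S ω|} ⊆ {ω | t ≤ S ω} ∪ {ω | t ≤ (-S) ω} := by
      intro ω hω
      simpa [le_abs] using hω
    have e3 : μ.real {ω | t ≤ |S ω|} ≤ _ :=
      (measureReal_mono hsub).trans (measureReal_union_le _ _)
    rw [← ofReal_measureReal]
    refine ENNReal.ofReal_le_ofReal ?_
    have e4 : -t ^ 2 / (2 * (c : ℝ)) = -(1 / (2 * c)) * t ^ (2 : ℝ) := by
      rw [Real.rpow_two]; ring
    rw [e4] at e1 e2
    linarith
  have hint : IntegrableOn (fun t : ℝ => t ^ ((j : ℝ) - 1) *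
      Real.exp (-(1 / (2 * c)) * t ^ (2 : ℝ))) (Set.Ioi 0) :=
    integrableOn_rpow_mul_exp_neg_mul_rpow (by linarith) two_pos (by positivity)
  have h2 : ∫⁻ t in Set.Ioi (0 : ℝ), μ {ω | t ≤ |S ω|} * ENNReal.ofReal (t ^ ((j : ℝ) - 1)) ≤
      ENNReal.ofReal (∫ t in Set.Ioi (0 : ℝ), 2 * (t ^ ((j : ℝ) - 1) *
        Real.exp (-(1 / (2 * c)) * t ^ (2 : ℝ)))) := by
    rw [ofReal_integral_eq_lintegral_ofReal (hint.const_mul 2)]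
    · refine setLIntegral_mono' measurableSet_Ioi fun t ht => ?_
      have ht : (0 : ℝ) < t := ht
      refine (mul_le_mul_left (tail t ht) _).trans (le_of_eq ?_)
      rw [← ENNReal.ofReal_mul (by positivity)]
      congr 1; ring
    · refine (ae_restrict_iff' measurableSet_Ioi).2 (ae_of_all _ fun t ht => ?_)
      have ht : (0 : ℝ) < t := ht
      simp only [Pi.zero_apply]; positivity
  refine (mul_le_mul_right h2 _).trans (le_of_eq ?_)
  rw [← ENNReal.ofReal_mul hj'.le, integral_const_mul,
    integral_rpow_mul_exp_neg_mul_rpow two_pos (by linarith) (by positivity)]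
  congr 1
  rw [sub_add_cancel, one_div, Real.inv_rpow (by positivity), ← Real.rpow_neg (by positivity),
    neg_div, neg_neg]
  ring

section Average

variable {Y : Type*} {k : ℕ}

/-- The average of `Z` over the coordinates in `A`. -/
noncomputable def avgOn (A : Finset (Fin k)) (Z : Y → ℝ) (z : Fin k → Y) : ℝ :=
  (A.card : ℝ)⁻¹ * ∑ a ∈ A, Z (z a)

theorem abs_avgOn_le {A : Finset (Fin k)} {Z : Y → ℝ} {B : ℝ} (hB : 0 ≤ B)
    (hZ : ∀ y, |Z y| ≤ B) (z : Fin k → Y) : |avgOn A Z z| ≤ B := by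
  rw [avgOn, abs_mul, abs_of_nonneg (by positivity)]
  have h : |∑ a ∈ A, Z (z a)| ≤ A.card * B := by
    refine (Finset.abs_sum_le_sum_abs _ _).trans ?_
    simpa using Finset.sum_le_sum fun a (_ : a ∈ A) => hZ (z a)
  rcases A.eq_empty_or_nonempty with rfl | hA
  · simpa using hB
  have : (0 : ℝ) < A.card := by exact_mod_cast hA.card_pos
  calc _ ≤ (A.card : ℝ)⁻¹ * (A.card * B) := by gcongr
    _ = B := by field_simp

theorem tsum_abs_avgOn_pow_le (ν : PMF (Fin k → Y)) {A : Finset (Fin k)} {Z : Y → ℝ} {B : ℝ}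
    (hB : 0 ≤ B) (hZ : ∀ y, |Z y| ≤ B) (j : ℕ) :
    ∑' z, (ν z).toReal * |avgOn A Z z| ^ j ≤ B ^ j := by
  have hle : ∀ z, |avgOn A Z z| ^ j ≤ B ^ j := fun z =>
    pow_le_pow_left₀ (abs_nonneg _) (abs_avgOn_le hB hZ z) j
  have h1 := (ν.hasSum_toReal.mul_right (B ^ j))
  rw [one_mul] at h1
  rw [← h1.tsum_eq]
  refine Summable.tsum_le_tsum (fun z => mul_le_mul_of_nonneg_left (hle z) ENNReal.toReal_nonneg)
    (ν.summable_toReal_mul (C := B ^ j) fun z => ?_) h1.summable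
  rw [abs_of_nonneg (by positivity)]; exact hle z

variable [Countable Y] {r : Fin k → PMF Y} {q : PMF Y} {A : Finset (Fin k)} {Z : Y → ℝ} {B : ℝ}

/-- Hoeffding's bound on the absolute moments of an average of independent centred variables. The
coordinates outside `A` have arbitrary laws. -/
theorem tsum_abs_avgOn_pow_le_gamma (hr : ∀ a ∈ A, r a = q) (hA : A.Nonempty)
    (hZ : ∀ y, |Z y| ≤ B) (hmean : ∑' y, (q y).toReal * Z y = 0) {j : ℕ} (hj : 0 < j) :
    ∑' z, (indepPMF r z).toReal * |avgOn A Z z| ^ j ≤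
      j * Real.Gamma ((j : ℝ) / 2) * (2 * B ^ 2 / A.card) ^ ((j : ℝ) / 2) := by
  let _ : MeasurableSpace Y := ⊤
  have : DiscreteMeasurableSpace Y := ⟨fun _ => trivial⟩
  have hcard : (0 : ℝ) < A.card := by exact_mod_cast hA.card_pos
  obtain ⟨y₀⟩ : Nonempty Y := by
    obtain ⟨y, -⟩ := q.support_nonempty
    exact ⟨y⟩
  have hB : 0 ≤ B := (abs_nonneg _).trans (hZ y₀)
  have hle : ∀ z, |avgOn A Z z| ^ j ≤ B ^ j := fun z =>
    pow_le_pow_left₀ (abs_nonneg _) (abs_avgOn_le hB hZ z) j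
  rw [PMF.tsum_toReal_mul_eq_integral (C := B ^ j) _
    fun z => by rw [abs_of_nonneg (by positivity)]; exact hle z]
  rw [PMF.tsum_toReal_mul_eq_integral q hZ] at hmean
  rw [indepPMF_toMeasure]
  set μ := Measure.pi fun a => (r a).toMeasure
  have hind : iIndepFun (fun (a : Fin k) (z : Fin k → Y) => Z (z a)) μ :=
    iIndepFun_pi (X := fun _ => Z) fun a => Measurable.of_discrete.aemeasurable
  have hsub : ∀ a ∈ A, HasSubgaussianMGF (fun z : Fin k → Y => Z (z a))
      ((‖B - -B‖₊ / 2) ^ 2) μ := by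
    intro a ha
    refine hasSubgaussianMGF_of_mem_Icc_of_integral_eq_zero Measurable.of_discrete.aemeasurable
      (ae_of_all _ fun z => abs_le.1 (hZ (z a))) ?_
    rw [← hmean, ← hr a ha, ← (measurePreserving_eval (fun a => (r a).toMeasure) a).map_eq,
      integral_map Measurable.of_discrete.aemeasurable
        Measurable.of_discrete.aestronglyMeasurable]
  have havg := (HasSubgaussianMGF.sum_of_iIndepFun hind hsub).const_mul (A.card : ℝ)⁻¹
  have hmom := havg.lintegral_abs_pow_le hj
  rw [integral_eq_lintegral_of_nonneg_ae (ae_of_all _ fun z => by positivity)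
    Measurable.of_discrete.aestronglyMeasurable]
  refine ENNReal.toReal_le_of_le_ofReal (by positivity) (hmom.trans (le_of_eq ?_))
  have hproxy : ((∑ _i ∈ A, (‖B - -B‖₊ / 2) ^ 2 : NNReal) : ℝ) = A.card * B ^ 2 := by
    simp only [Finset.sum_const, nsmul_eq_mul, sub_neg_eq_add, NNReal.coe_mul, NNReal.coe_natCast,
      NNReal.coe_pow, NNReal.coe_div, coe_nnnorm, Real.norm_eq_abs, NNReal.coe_ofNat]
    rw [abs_of_nonneg (by linarith)]
    ring
  have hvar : 2 * (((A.card : ℝ)⁻¹ ^ 2) * ((∑ _i ∈ A, (‖B - -B‖₊ / 2) ^ 2 : NNReal) : ℝ)) =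
      2 * B ^ 2 / A.card := by
    rw [hproxy]; field_simp
  congr 3

/-- The second moment of an average of independent centred variables is the second moment of one
of them over their number. The coordinates outside `A` have arbitrary laws. -/
theorem tsum_abs_avgOn_sq_le (hr : ∀ a ∈ A, r a = q) (hA : A.Nonempty)
    (hZ : ∀ y, |Z y| ≤ B) (hmean : ∑' y, (q y).toReal * Z y = 0) {V : ℝ}
    (hV : ∑' y, (q y).toReal * Z y ^ 2 ≤ V) :
    ∑' z, (indepPMF r z).toReal * |avgOn A Z z| ^ 2 ≤ V / A.card := by
  let _ : MeasurableSpace Y := ⊤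
  have : DiscreteMeasurableSpace Y := ⟨fun _ => trivial⟩
  have hcard : (0 : ℝ) < A.card := by exact_mod_cast hA.card_pos
  obtain ⟨y₀⟩ : Nonempty Y := by
    obtain ⟨y, -⟩ := q.support_nonempty
    exact ⟨y⟩
  have hB : 0 ≤ B := (abs_nonneg _).trans (hZ y₀)
  have hle : ∀ z, |avgOn A Z z| ^ 2 ≤ B ^ 2 := fun z =>
    pow_le_pow_left₀ (abs_nonneg _) (abs_avgOn_le hB hZ z) 2
  rw [PMF.tsum_toReal_mul_eq_integral (C := B ^ 2) _
    fun z => by rw [abs_of_nonneg (by positivity)]; exact hle z]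
  rw [PMF.tsum_toReal_mul_eq_integral q hZ] at hmean
  rw [PMF.tsum_toReal_mul_eq_integral (C := B ^ 2) q fun z => by
    rw [abs_pow]; exact pow_le_pow_left₀ (abs_nonneg _) (hZ z) 2] at hV
  rw [indepPMF_toMeasure]
  set X : Fin k → Y → ℝ := fun a y => if a ∈ A then Z y else 0 with hX
  have hXb : ∀ a y, |X a y| ≤ B := fun a y => by
    simp only [hX]; split_ifs
    · exact hZ y
    · simpa using hB
  have hXmem : ∀ a, MemLp (X a) 2 (r a).toMeasure := fun a =>
    MemLp.of_bound Measurable.of_discrete.aestronglyMeasurable B (ae_of_all _ (hXb a))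
  have hXmean : ∀ a, ∫ y, X a y ∂(r a).toMeasure = 0 := by
    intro a
    by_cases ha : a ∈ A
    · simpa [hX, ha, hr a ha] using hmean
    · simp [hX, ha]
  have hsum : (fun z : Fin k → Y => ∑ a ∈ A, Z (z a)) = ∑ a, fun z : Fin k → Y => X a (z a) := by
    ext z
    simp [hX, Finset.sum_apply, Finset.sum_ite_mem]
  have hvar := variance_sum_pi hXmem
  have hmean0 : (Measure.pi fun a => (r a).toMeasure)[∑ a, fun z : Fin k → Y => X a (z a)] = 0 := by
    simp only [Finset.sum_apply]
    rw [integral_finsetSum]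
    · refine Finset.sum_eq_zero fun a _ => ?_
      rw [← hXmean a, ← (measurePreserving_eval (fun a => (r a).toMeasure) a).map_eq,
        integral_map Measurable.of_discrete.aemeasurable
          Measurable.of_discrete.aestronglyMeasurable]
    · exact fun a _ => Integrable.of_bound Measurable.of_discrete.aestronglyMeasurable B
        (ae_of_all _ fun z => hXb a _)
  rw [variance_of_integral_eq_zero Measurable.of_discrete.aemeasurable hmean0, ← hsum] at hvar
  have hvar' : ∀ a, Var[X a; (r a).toMeasure] ≤ if a ∈ A then V else 0 := by
    intro a
    rw [variance_of_integral_eq_zero Measurable.of_discrete.aemeasurable (hXmean a)]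
    by_cases ha : a ∈ A
    · simpa [hX, ha, hr a ha] using hV
    · simp [hX, ha]
  have hle2 := Finset.sum_le_sum fun a (_ : a ∈ Finset.univ) => hvar' a
  rw [← hvar] at hle2
  simp only [Finset.sum_ite_mem, Finset.univ_inter, Finset.sum_const, nsmul_eq_mul] at hle2
  have hfac : ∀ z : Fin k → Y, |avgOn A Z z| ^ 2 =
      ((A.card : ℝ)⁻¹) ^ 2 * (∑ a ∈ A, Z (z a)) ^ 2 := fun z => by
    rw [sq_abs, avgOn, mul_pow]
  simp only [hfac, integral_const_mul]
  calc _ ≤ ((A.card : ℝ)⁻¹) ^ 2 * (A.card * V) := by gcongr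
    _ = V / A.card := by field_simp

end Average

end Moments

/-! ### Jensen's inequality for mixtures, and a binomial tail bound -/

section Jensen

variable {Z I : Type*}

/-- Jensen's inequality for `|·| ^ j` under the weights `c`, whose total `∑ c` is `Q`. -/
theorem mul_abs_div_pow_le {s : Finset I} {c W : I → ℝ} {Q γ x : ℝ}
    (hc : ∀ i ∈ s, 0 ≤ c i) (hγ : 0 ≤ γ) (hQ : 0 < Q) (hcQ : Q = ∑ i ∈ s, c i)
    (hx : x = γ * ∑ i ∈ s, c i * W i) (j : ℕ) :
    Q * |x / Q| ^ j ≤ γ ^ j * ∑ i ∈ s, c i * |W i| ^ j := by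
  have hw : ∀ i ∈ s, 0 ≤ c i / Q := fun i hi => div_nonneg (hc i hi) hQ.le
  have h1 : |x / Q| ≤ γ * ∑ i ∈ s, c i / Q * |W i| := by
    have : x / Q = γ * ∑ i ∈ s, c i / Q * W i := by
      rw [hx, mul_div_assoc, Finset.sum_div]
      congr 1
      exact Finset.sum_congr rfl fun i _ => by ring
    rw [this, abs_mul, abs_of_nonneg hγ]
    refine mul_le_mul_of_nonneg_left ((Finset.abs_sum_le_sum_abs _ _).trans (le_of_eq ?_)) hγ
    exact Finset.sum_congr rfl fun i hi => by rw [abs_mul, abs_of_nonneg (hw i hi)]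
  have h2 := Real.pow_arith_mean_le_arith_mean_pow s (fun i => c i / Q) (fun i => |W i|) hw
    (by rw [← Finset.sum_div, ← hcQ, div_self hQ.ne']) (fun i _ => abs_nonneg _) j
  have h3 : |x / Q| ^ j ≤ γ ^ j * ∑ i ∈ s, c i / Q * |W i| ^ j := by
    refine (pow_le_pow_left₀ (abs_nonneg _) h1 j).trans ?_
    rw [mul_pow]
    exact mul_le_mul_of_nonneg_left h2 (pow_nonneg hγ j)
  calc Q * |x / Q| ^ j ≤ Q * (γ ^ j * ∑ i ∈ s, c i / Q * |W i| ^ j) := by gcongr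
    _ = γ ^ j * ∑ i ∈ s, c i * |W i| ^ j := by
      rw [mul_left_comm, Finset.mul_sum]
      congr 1
      exact Finset.sum_congr rfl fun i _ => by field_simp

/-- The Rényi integrand as a power of the relative deviation of `P` from `Q`. -/
theorem pow_mul_pow_one_sub_eq {p q : ℝ≥0∞} (hp : p ≠ ∞) (hq : q ≠ ∞) (hpq : q = 0 → p = 0)
    {m : ℕ} (hm : 0 < m) :
    p ^ (m : ℝ) * q ^ (1 - (m : ℝ)) =
      ENNReal.ofReal (q.toReal * (1 + (p.toReal - q.toReal) / q.toReal) ^ m) := by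
  rcases eq_or_ne q 0 with h0 | h0
  · rw [hpq h0, h0, ENNReal.zero_rpow_of_pos (by exact_mod_cast hm)]
    simp
  lift p to NNReal using hp
  lift q to NNReal using hq
  have hq0 : q ≠ 0 := by exact_mod_cast h0
  have hq0' : (q : ℝ) ≠ 0 := by exact_mod_cast hq0
  rw [ENNReal.rpow_natCast, ← ENNReal.coe_rpow_of_ne_zero hq0, ← ENNReal.coe_pow,
    ← ENNReal.coe_mul, ENNReal.coe_toReal, ENNReal.coe_toReal,
    show (1 : ℝ) + (p - q) / q = p / q by field_simp; ring,
    ENNReal.ofReal, ENNReal.coe_inj]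
  ext
  rw [Real.coe_toNNReal _ (by positivity), NNReal.coe_mul, NNReal.coe_rpow, NNReal.coe_pow,
    Real.rpow_sub (by positivity), Real.rpow_one, Real.rpow_natCast, div_pow]
  ring

/-- If `Q = ∑ c ν` is a finite mixture and `P - Q = γ ∑ c ν W`, then the relative deviation
`(P - Q) / Q` is `γ` times a conditional mean of `W`, so by the binomial expansion and Jensen's
inequality the Rényi sum of `P` against `Q` is at most `1` plus the weighted absolute moments of
`W`. The term linear in `P - Q` vanishes because `P` and `Q` have the same total mass. -/
theorem tsum_pow_mul_pow_one_sub_le {s : Finset I} {c : I → ℝ} {ν : I → PMF Z} {W : I → Z → ℝ}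
    {P Q : PMF Z} {B γ : ℝ} (hc : ∀ i ∈ s, 0 ≤ c i) (hγ : 0 ≤ γ) (hW : ∀ i z, |W i z| ≤ B)
    (hQ : ∀ z, (Q z).toReal = ∑ i ∈ s, c i * (ν i z).toReal)
    (hP : ∀ z, (P z).toReal - (Q z).toReal = γ * ∑ i ∈ s, c i * ((ν i z).toReal * W i z))
    {m : ℕ} (hm : 2 ≤ m) :
    ∑' z, P z ^ (m : ℝ) * Q z ^ (1 - (m : ℝ)) ≤
      ENNReal.ofReal (1 + ∑ j ∈ Finset.Icc 2 m, (m.choose j : ℝ) * γ ^ j *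
        ∑ i ∈ s, c i * ∑' z, (ν i z).toReal * |W i z| ^ j) := by
  set g : Z → ℝ := fun z => (Q z).toReal + m * ((P z).toReal - (Q z).toReal) +
    ∑ j ∈ Finset.Icc 2 m, (m.choose j : ℝ) * γ ^ j *
        ∑ i ∈ s, c i * ((ν i z).toReal * |W i z| ^ j) with hg
  have hsum : HasSum g (1 + m * (1 - 1) + ∑ j ∈ Finset.Icc 2 m, (m.choose j : ℝ) * γ ^ j *
        ∑ i ∈ s, c i * ∑' z, (ν i z).toReal * |W i z| ^ j) := by
    refine (Q.hasSum_toReal.add ((P.hasSum_toReal.sub Q.hasSum_toReal).mul_left _)).add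
      (hasSum_sum fun j _ => (hasSum_sum fun i _ => ?_).mul_left _)
    refine (Summable.hasSum ?_).mul_left _
    refine (ν i).summable_toReal_mul (C := B ^ j) fun z => ?_
    rw [abs_of_nonneg (by positivity)]
    exact pow_le_pow_left₀ (abs_nonneg _) (hW i z) j
  have hcν : ∀ z, ∀ i ∈ s, 0 ≤ c i * (ν i z).toReal := fun z i hi =>
    mul_nonneg (hc i hi) ENNReal.toReal_nonneg
  have hzero : ∀ z, Q z = 0 → P z = 0 := by
    intro z hz
    have h1 := hQ z
    have h2 := hP z
    rw [hz, ENNReal.toReal_zero] at h1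
    rw [Finset.sum_eq_zero, hz, mul_zero, ENNReal.toReal_zero, sub_zero] at h2
    · exact ((ENNReal.toReal_eq_zero_iff _).1 h2).resolve_right (P.apply_ne_top z)
    · intro i hi
      rw [← mul_assoc, (Finset.sum_eq_zero_iff_of_nonneg (hcν z)).1 h1.symm i hi, zero_mul]
  have hg0 : ∀ z, (Q z).toReal * (1 + ((P z).toReal - (Q z).toReal) / (Q z).toReal) ^ m ≤ g z := by
    intro z
    rcases eq_or_ne (Q z) 0 with h0 | h0
    · have hP0 := hzero z h0
      simp only [hg, h0, hP0, ENNReal.toReal_zero, zero_mul, sub_zero, mul_zero, zero_add]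
      refine Finset.sum_nonneg fun j _ => mul_nonneg (by positivity)
        (Finset.sum_nonneg fun i hi => ?_)
      rw [← mul_assoc]
      exact mul_nonneg (hcν z i hi) (by positivity)
    have hQpos : 0 < (Q z).toReal := ENNReal.toReal_pos h0 (Q.apply_ne_top z)
    set x := (P z).toReal - (Q z).toReal with hx
    have hterm : ∀ j, (Q z).toReal * (x / (Q z).toReal) ^ j ≤
        γ ^ j * ∑ i ∈ s, c i * ((ν i z).toReal * |W i z| ^ j) := by
      intro j
      have h := mul_abs_div_pow_le (hcν z) hγ hQpos (hQ z) (x := x) (W := fun i => W i z)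
        (by rw [hx, hP z]; congr 1; exact Finset.sum_congr rfl fun i _ => by ring) j
      refine le_trans ?_ (h.trans (le_of_eq ?_))
      · rw [← abs_pow]
        exact mul_le_mul_of_nonneg_left (le_abs_self _) hQpos.le
      · congr 1; exact Finset.sum_congr rfl fun i _ => by ring
    have hrange : Finset.range (m + 1) = insert 0 (insert 1 (Finset.Icc 2 m)) := by
      ext j; simp only [Finset.mem_range, Finset.mem_insert, Finset.mem_Icc]; omega
    have hexp : (Q z).toReal * (1 + x / (Q z).toReal) ^ m = (Q z).toReal + m * x +
        ∑ j ∈ Finset.Icc 2 m, (m.choose j : ℝ) * ((Q z).toReal * (x / (Q z).toReal) ^ j) := by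
      rw [add_comm 1, add_pow, hrange, Finset.sum_insert (by simp), Finset.sum_insert (by simp)]
      simp only [one_pow, mul_one, pow_zero, pow_one, Nat.choose_zero_right, Nat.choose_one_right,
        Nat.cast_one]
      rw [mul_add, mul_add, Finset.mul_sum, ← add_assoc]
      congr 1
      · field_simp
      · exact Finset.sum_congr rfl fun j _ => by ring
    rw [hexp, hg]
    refine add_le_add_right (Finset.sum_le_sum fun j _ => ?_) _
    rw [mul_assoc]
    exact mul_le_mul_of_nonneg_left (hterm j) (by positivity)
  have hgnn : ∀ z, 0 ≤ g z := by
    intro z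
    refine le_trans ?_ (hg0 z)
    rcases eq_or_ne (Q z) 0 with h0 | h0
    · simp [h0]
    have hQpos : 0 < (Q z).toReal := ENNReal.toReal_pos h0 (Q.apply_ne_top z)
    rw [show 1 + ((P z).toReal - (Q z).toReal) / (Q z).toReal = (P z).toReal / (Q z).toReal by
      field_simp; ring]
    positivity
  calc ∑' z, P z ^ (m : ℝ) * Q z ^ (1 - (m : ℝ)) ≤ ∑' z, ENNReal.ofReal (g z) := by
        refine ENNReal.tsum_le_tsum fun z => ?_
        rw [pow_mul_pow_one_sub_eq (P.apply_ne_top z) (Q.apply_ne_top z) (hzero z) (by omega)]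
        exact ENNReal.ofReal_le_ofReal (hg0 z)
    _ = ENNReal.ofReal (∑' z, g z) := (ENNReal.ofReal_tsum_of_nonneg hgnn hsum.summable).symm
    _ = _ := by rw [hsum.tsum_eq, sub_self, mul_zero, add_zero]

end Jensen

section Binomial

variable {ι : Type*}

theorem sum_powerset_erase_insert [DecidableEq ι] {M : Type*} [AddCommMonoid M] [Fintype ι] (b : ι)
    (f : Finset ι → M) :
    ∑ C ∈ (Finset.univ.erase b).powerset, f (insert b C) =
      ∑ A : Finset ι with b ∈ A, f A := by
  refine Finset.sum_bij' (fun C _ => insert b C) (fun A _ => A.erase b) ?_ ?_ ?_ ?_ ?_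
  · intro C _; simp
  · intro A _
    exact Finset.mem_powerset.2 (Finset.erase_subset_erase b (Finset.subset_univ A))
  · intro C hC
    refine Finset.erase_insert fun hb => ?_
    simpa using Finset.mem_powerset.1 hC hb
  · intro A hA
    exact Finset.insert_erase (by simpa using hA)
  · intro C _; rfl

theorem notMem_of_mem_powerset_erase [DecidableEq ι] {s C : Finset ι} {b : ι}
    (hC : C ∈ (s.erase b).powerset) :
    b ∉ C := fun hb => by simpa using Finset.mem_powerset.1 hC hb

/-- Chernoff's bound for the lower tail of a binomial variable with success probability `θ`, at
half its mean, stated for the size of a random subset of `s`. -/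
theorem sum_powerset_card_le_half_mean {s : Finset ι} {θ : ℝ} (h0 : 0 ≤ θ) (h1 : θ ≤ 1) :
    ∑ C ∈ s.powerset with (C.card : ℝ) ≤ s.card * θ / 2,
      θ ^ C.card * (1 - θ) ^ (s.card - C.card) ≤ Real.exp (-(s.card * θ / 8)) := by
  set x : ℝ := s.card * θ / 2 with hx
  have hθ : 0 ≤ 1 - θ := by linarith
  -- the event `|C| ≤ x` has indicator at most `2 ^ (x - |C|)`
  have hstep : ∑ C ∈ s.powerset with (C.card : ℝ) ≤ x, θ ^ C.card * (1 - θ) ^ (s.card - C.card) ≤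
      ∑ C ∈ s.powerset, (2 : ℝ) ^ x * ((θ / 2) ^ C.card * (1 - θ) ^ (s.card - C.card)) := by
    rw [Finset.sum_filter]
    refine Finset.sum_le_sum fun C _ => ?_
    split_ifs with h
    · have h2 : (2 : ℝ) ^ C.card ≤ 2 ^ x := by
        rw [← Real.rpow_natCast]
        exact Real.rpow_le_rpow_of_exponent_le one_le_two h
      rw [div_pow, ← mul_assoc, ← mul_div_assoc]
      refine mul_le_mul_of_nonneg_right ?_ (by positivity)
      rw [le_div_iff₀ (by positivity), mul_comm]
      exact mul_le_mul_of_nonneg_right h2 (by positivity)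
    · positivity
  refine hstep.trans ?_
  rw [← Finset.mul_sum, Finset.sum_pow_mul_eq_add_pow]
  have hexp : (θ / 2 + (1 - θ)) ^ s.card ≤ Real.exp (-x) := by
    have : θ / 2 + (1 - θ) ≤ Real.exp (-(θ / 2)) := by
      have := Real.add_one_le_exp (-(θ / 2)); linarith
    calc _ ≤ Real.exp (-(θ / 2)) ^ s.card := pow_le_pow_left₀ (by linarith) this _
      _ = Real.exp (-x) := by rw [← Real.exp_nat_mul]; congr 1; rw [hx]; ring
  have hxnn : 0 ≤ x := by positivity
  calc (2 : ℝ) ^ x * (θ / 2 + (1 - θ)) ^ s.card ≤ Real.exp (Real.log 2 * x) * Real.exp (-x) := by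
        rw [← Real.rpow_def_of_pos two_pos]; gcongr
    _ = Real.exp (-((1 - Real.log 2) * x)) := by rw [← Real.exp_add]; congr 1; ring
    _ ≤ Real.exp (-(s.card * θ / 8)) := by
      refine Real.exp_le_exp.2 (neg_le_neg ?_)
      have := Real.log_two_lt_d9
      calc (s.card * θ / 8 : ℝ) = 1 / 4 * x := by rw [hx]; ring
        _ ≤ _ := mul_le_mul_of_nonneg_right (by linarith) hxnn

end Binomial

/-! ### The output law of the mechanism -/

section Law

variable {X Y : Type*} {n k : ℕ}

theorem ENNReal.tsum_prod_pi :
    ∀ {n : ℕ} (h : Fin n → Y → ℝ≥0∞), ∑' y : Fin n → Y, ∏ i, h i (y i) = ∏ i, ∑' y, h i y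
  | 0, h => by simp
  | n + 1, h => by
    rw [← (Fin.consEquiv (fun _ : Fin (n + 1) => Y)).tsum_eq]
    simp only [Fin.consEquiv_apply, Fin.prod_univ_succ, Fin.cons_zero, Fin.cons_succ]
    rw [ENNReal.tsum_prod']
    simp only [ENNReal.tsum_mul_left, ENNReal.tsum_mul_right]
    rw [ENNReal.tsum_prod_pi (fun i => h i.succ)]

/-- Selecting distinct coordinates of an independent family gives an independent family. -/
theorem indepPMF_map_comp (p : Fin n → PMF Y) (f : Fin k ↪ Fin n) :
    (indepPMF p).map (fun y => y ∘ f) = indepPMF (p ∘ f) := by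
  classical
  ext w
  rw [PMF.map_apply]
  trans ∏ i, ∑' y, p i y * if ∃ a, f a = i ∧ w a ≠ y then 0 else 1
  · rw [← ENNReal.tsum_prod_pi (fun i y => p i y * if ∃ a, f a = i ∧ w a ≠ y then 0 else 1)]
    refine tsum_congr fun y => ?_
    rw [Finset.prod_mul_distrib]
    split_ifs with h
    · rw [Finset.prod_eq_one (f := fun i => if ∃ a, f a = i ∧ w a ≠ y i then (0 : ℝ≥0∞) else 1),
        mul_one]
      · rfl
      · rintro i -
        refine if_neg ?_
        rintro ⟨a, rfl, ha⟩
        exact ha (congrFun h a)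
    · obtain ⟨a, ha⟩ := Function.ne_iff.1 h
      rw [Finset.prod_eq_zero (f := fun i => if ∃ a, f a = i ∧ w a ≠ y i then (0 : ℝ≥0∞) else 1)
        (Finset.mem_univ (f a)) (if_pos ⟨a, rfl, ha⟩), mul_zero]
  change _ = ∏ a, (p ∘ f) a (w a)
  symm
  refine Fintype.prod_of_injective f f.injective _ _ ?_ ?_
  · intro i hi
    refine Eq.trans (tsum_congr fun y => ?_) (p i).tsum_coe
    rw [if_neg, mul_one]
    rintro ⟨a, rfl, -⟩
    exact hi ⟨a, rfl⟩
  · intro a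
    rw [tsum_eq_single (w a)]
    · rw [if_neg, mul_one]; · rfl
      rintro ⟨a', ha', hne⟩
      exact hne (congrArg w (f.injective ha'))
    · intro y hy
      rw [if_pos ⟨a, rfl, hy.symm⟩, mul_zero]

/-- A `k`-subset of `Fin n` together with an ordering of it is an injection `Fin k ↪ Fin n`. -/
theorem bijective_orderEmbOfFin_comp_perm :
    Function.Bijective (fun x : {S : Finset (Fin n) // S.card = k} × Equiv.Perm (Fin k) =>
      x.2.toEmbedding.trans (x.1.1.orderEmbOfFin x.1.2).toEmbedding) := by
  constructor
  · rintro ⟨⟨S, hS⟩, σ⟩ ⟨⟨T, hT⟩, τ⟩ h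
    have hfun : ∀ a, S.orderEmbOfFin hS (σ a) = T.orderEmbOfFin hT (τ a) := fun a =>
      DFunLike.congr_fun h a
    have hST : S = T := by
      rw [← Finset.coe_inj, ← Finset.range_orderEmbOfFin S hS, ← Finset.range_orderEmbOfFin T hT,
        ← σ.surjective.range_comp (S.orderEmbOfFin hS),
        ← τ.surjective.range_comp (T.orderEmbOfFin hT)]
      exact congrArg Set.range (funext hfun)
    subst hST
    have : σ = τ := Equiv.ext fun a => (S.orderEmbOfFin hS).injective (hfun a)
    rw [this]
  · intro f
    have hcard : (Finset.univ.map f).card = k := by simp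
    have hmem : ∀ a, f a ∈ Set.range ((Finset.univ.map f).orderEmbOfFin hcard) := fun a => by
      rw [Finset.range_orderEmbOfFin]; simp
    choose s hs using hmem
    have hsinj : Function.Injective s := fun a b hab => f.injective (by rw [← hs, ← hs, hab])
    refine ⟨⟨⟨Finset.univ.map f, hcard⟩,
      Equiv.ofBijective s (Finite.injective_iff_bijective.1 hsinj)⟩, ?_⟩
    ext a
    simp [hs]

/-- Averaging over injections `Fin k ↪ Fin n` is averaging over permutations of `Fin n`,
restricted to the first `k` points. -/
theorem card_mul_sum_perm_castLE (hkn : k ≤ n) {M : Type*} [CommSemiring M]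
    (Φ : (Fin k → Fin n) → M) :
    (Fintype.card (Fin k ↪ Fin n) : M) *
        ∑ π : Equiv.Perm (Fin n), Φ (fun a => π (Fin.castLE hkn a)) =
      (n.factorial : M) * ∑ f : Fin k ↪ Fin n, Φ f := by
  have h1 : ∀ π : Equiv.Perm (Fin n), ∑ f : Fin k ↪ Fin n, Φ (fun a => π (f a)) =
      ∑ f : Fin k ↪ Fin n, Φ f := fun π =>
    (Equiv.embeddingCongr (Equiv.refl (Fin k)) π).sum_comp (fun f => Φ f)
  have h2 : ∀ f : Fin k ↪ Fin n, ∑ π : Equiv.Perm (Fin n), Φ (fun a => π (f a)) =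
      ∑ π : Equiv.Perm (Fin n), Φ (fun a => π (Fin.castLE hkn a)) := by
    intro f
    have := Equiv.Perm.isMultiplyPretransitive (Fin n) k
    obtain ⟨τ, hτ⟩ := MulAction.exists_smul_eq (Equiv.Perm (Fin n))
      (Fin.castLEEmb hkn : Fin k ↪ Fin n) f
    rw [← hτ]
    exact Equiv.sum_comp (Equiv.mulRight τ)
      (fun π : Equiv.Perm (Fin n) => Φ (fun a => π (Fin.castLE hkn a)))
  have h3 := Finset.sum_comm (s := (Finset.univ : Finset (Equiv.Perm (Fin n))))
    (t := (Finset.univ : Finset (Fin k ↪ Fin n))) (f := fun π f => Φ (fun a => π (f a)))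
  simp only [h1, h2, Finset.sum_const, Finset.card_univ, nsmul_eq_mul, Fintype.card_perm,
    Fintype.card_fin] at h3
  exact h3.symm

/-- The output law of the subsampled shuffle mechanism: the messages are assigned to the output
slots by a uniformly random permutation of the users, of which the first `k` are kept. -/
theorem subsampledShuffle_apply_toReal (R : X → PMF Y) (hkn : k ≤ n) (D : Fin n → X)
    (z : Fin k → Y) :
    (subsampledShuffle R hkn D z).toReal = (n.factorial : ℝ)⁻¹ *
      ∑ π : Equiv.Perm (Fin n), ∏ a, (R (D (π (Fin.castLE hkn a))) (z a)).toReal := by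
  have := nonempty_ksubset hkn
  have hlaw : subsampledShuffle R hkn D =
      (PMF.uniformOfFintype {S : Finset (Fin n) // S.card = k}).bind fun S =>
        (PMF.uniformOfFintype (Equiv.Perm (Fin k))).bind fun σ =>
          indepPMF fun a => R (D (S.1.orderEmbOfFin S.2 (σ a))) := by
    have hmap : ∀ (S : {S : Finset (Fin n) // S.card = k}) (σ : Equiv.Perm (Fin k)),
        indepPMF (fun a => R (D (S.1.orderEmbOfFin S.2 (σ a)))) =
        (indepPMF fun i => R (D i)).map
          (fun y => fun a => y (S.1.orderEmbOfFin S.2 (σ a))) := fun S σ =>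
      (indepPMF_map_comp (fun i => R (D i))
        (σ.toEmbedding.trans (S.1.orderEmbOfFin S.2).toEmbedding)).symm
    have hshuffle : ∀ y : Fin k → Y, shuffle y =
        (PMF.uniformOfFintype (Equiv.Perm (Fin k))).bind fun σ => PMF.pure (y ∘ σ) := by
      intro y
      change ((PMF.uniformOfFintype (Equiv.Perm (Fin k))).bind fun σ => PMF.pure ⇑σ).bind _ = _
      simp [PMF.bind_bind, PMF.pure_bind]
    simp only [hmap]
    unfold subsampledShuffle samp
    simp only [hshuffle, PMF.map, PMF.bind_bind, PMF.pure_bind, Function.comp_def]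
    rw [PMF.bind_comm]
    congr 1
    ext1 S
    rw [PMF.bind_comm]
  have hval : (subsampledShuffle R hkn D z).toReal =
      (Fintype.card {S : Finset (Fin n) // S.card = k} : ℝ)⁻¹ *
        ((k.factorial : ℝ)⁻¹ * ∑ f : Fin k ↪ Fin n, ∏ a, (R (D (f a)) (z a)).toReal) := by
    have hsum := (bijective_orderEmbOfFin_comp_perm (n := n) (k := k)).sum_comp
      (fun f : Fin k ↪ Fin n => ∏ a, (R (D (f a)) (z a)).toReal)
    rw [← hsum, Fintype.sum_prod_type, hlaw]
    simp only [PMF.bind_apply, PMF.uniformOfFintype_apply, tsum_fintype, ← Finset.mul_sum,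
      ENNReal.toReal_mul, ENNReal.toReal_inv, ENNReal.toReal_natCast, Fintype.card_perm,
      Fintype.card_fin]
    have hne : ∀ S : {S : Finset (Fin n) // S.card = k}, ∑ σ : Equiv.Perm (Fin k),
        indepPMF (fun a => R (D (S.1.orderEmbOfFin S.2 (σ a)))) z ≠ ∞ := fun S =>
      ENNReal.sum_ne_top.2 fun σ _ => PMF.apply_ne_top _ _
    rw [ENNReal.toReal_sum fun S _ => hne S]
    congr 2
    refine Finset.sum_congr rfl fun S _ => ?_
    rw [ENNReal.toReal_sum fun σ _ => PMF.apply_ne_top _ _]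
    exact Finset.sum_congr rfl fun σ _ => ENNReal.toReal_prod Finset.univ
      fun a => R (D (S.1.orderEmbOfFin S.2 (σ a))) (z a)
  have hcard : (Fintype.card (Fin k ↪ Fin n) : ℝ) =
      Fintype.card {S : Finset (Fin n) // S.card = k} * k.factorial := by
    rw [← Fintype.card_of_bijective (bijective_orderEmbOfFin_comp_perm (n := n) (k := k)),
      Fintype.card_prod, Fintype.card_perm, Fintype.card_fin]
    push_cast; rfl
  have hS : (Fintype.card {S : Finset (Fin n) // S.card = k} : ℝ) ≠ 0 := by
    exact_mod_cast Fintype.card_ne_zero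
  have havg := card_mul_sum_perm_castLE hkn (M := ℝ) fun f => ∏ a, (R (D (f a)) (z a)).toReal
  rw [hcard] at havg
  rw [hval]
  field_simp
  linarith

end Law

/-! ### Sums over permutations -/

section PermSum

variable {n k : ℕ}

theorem sum_lt_eq_sum_castLE (hkn : k ≤ n) (V : Fin n → ℝ) :
    ∑ m : Fin n with m.val < k, V m = ∑ b : Fin k, V (Fin.castLE hkn b) := by
  symm
  refine Finset.sum_bij (fun b _ => Fin.castLE hkn b) ?_ ?_ ?_ ?_
  · intro b _; simp
  · intro b _ c _ h; exact Fin.castLE_injective hkn h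
  · intro m hm
    exact ⟨⟨m, by simpa using hm⟩, Finset.mem_univ _, rfl⟩
  · intro b _; rfl

theorem update_perm_of_ne {f : Fin n → Fin k → ℝ} {g : Fin k → ℝ} {i m m' : Fin n}
    {π : Equiv.Perm (Fin n)} (hπ : π m = i) (hm : m' ≠ m) :
    Function.update f i g (π m') = f (π m') :=
  Function.update_of_ne (fun h => hm (π.injective (h.trans hπ.symm))) _ _

/-- The part of the permutation sum in which `i` sits at a given position `ι b < k`. -/
theorem prod_update_eq (hkn : k ≤ n) (f : Fin n → Fin k → ℝ) (g : Fin k → ℝ) {i : Fin n}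
    {π : Equiv.Perm (Fin n)} {b : Fin k} (hπ : π (Fin.castLE hkn b) = i) :
    ∏ a, Function.update f i g (π (Fin.castLE hkn a)) a =
      (∏ a ∈ Finset.univ.erase b, f (π (Fin.castLE hkn a)) a) * g b := by
  rw [← Finset.prod_erase_mul _ _ (Finset.mem_univ b), hπ, Function.update_self]
  congr 1
  refine Finset.prod_congr rfl fun a ha => ?_
  rw [update_perm_of_ne hπ fun h => Finset.ne_of_mem_erase ha (Fin.castLE_injective hkn h)]

theorem sum_sum_perm_apply_eq (i : Fin n) (F : Equiv.Perm (Fin n) → ℝ) :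
    ∑ m : Fin n, ∑ π : Equiv.Perm (Fin n) with π m = i, F π = ∑ π, F π := by
  simp only [Finset.sum_filter]
  rw [Finset.sum_comm]
  refine Finset.sum_congr rfl fun π _ => ?_
  rw [Finset.sum_eq_single (π.symm i)]
  · simp
  · intro m _ hm
    exact if_neg fun h => hm (by rw [← h, Equiv.symm_apply_apply])
  · simp

/-- A permutation that places `i` outside the first `k` positions is obtained in `k` ways from one
that places `i` at a position `ι b < k`, by exchanging the contents of `ι b` and of an outside
position `m`. -/
theorem card_mul_sum_perm_prod_update (hkn : k ≤ n) (f : Fin n → Fin k → ℝ) (g : Fin k → ℝ)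
    (i : Fin n) :
    k * ∑ π : Equiv.Perm (Fin n), ∏ a, Function.update f i g (π (Fin.castLE hkn a)) a =
      ∑ b, ∑ π : Equiv.Perm (Fin n) with π (Fin.castLE hkn b) = i,
        (∏ a ∈ Finset.univ.erase b, f (π (Fin.castLE hkn a)) a) *
          ∑ m : Fin n, if (m : ℕ) < k then g b else f (π m) b := by
  set V : Fin n → ℝ := fun m => ∑ π : Equiv.Perm (Fin n) with π m = i,
    ∏ a, Function.update f i g (π (Fin.castLE hkn a)) a with hV
  have hbm : ∀ (b : Fin k) (m : Fin n), ∑ π : Equiv.Perm (Fin n) with π (Fin.castLE hkn b) = i,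
      (∏ a ∈ Finset.univ.erase b, f (π (Fin.castLE hkn a)) a) *
        (if (m : ℕ) < k then g b else f (π m) b) =
      if (m : ℕ) < k then V (Fin.castLE hkn b) else V m := by
    intro b m
    split_ifs with hm
    · refine Finset.sum_congr rfl fun π hπ => ?_
      rw [prod_update_eq hkn f g (Finset.mem_filter.1 hπ).2]
    · have hne : ∀ a : Fin k, Fin.castLE hkn a ≠ m := fun a h => hm (h ▸ a.2)
      refine Finset.sum_equiv (Equiv.mulRight (Equiv.swap (Fin.castLE hkn b) m)) ?_ ?_
      · intro π; simp
      · intro π hπ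
        have hπ := (Finset.mem_filter.1 hπ).2
        rw [← Finset.prod_erase_mul _ _ (Finset.mem_univ b)]
        simp only [Equiv.coe_mulRight, Equiv.Perm.coe_mul, Function.comp_apply,
          Equiv.swap_apply_left]
        rw [update_perm_of_ne hπ (hne b).symm]
        congr 1
        refine Finset.prod_congr rfl fun a ha => ?_
        have hab : Fin.castLE hkn a ≠ Fin.castLE hkn b := fun h =>
          Finset.ne_of_mem_erase ha (Fin.castLE_injective hkn h)
        rw [Equiv.swap_apply_of_ne_of_ne hab (hne a), update_perm_of_ne hπ hab]
  have hcount : ∑ m : Fin n with m.val < k, (1 : ℝ) = k := by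
    rw [sum_lt_eq_sum_castLE hkn]; simp
  simp only [Finset.mul_sum (Finset.univ : Finset (Fin n))]
  rw [Finset.sum_congr rfl fun b _ => Finset.sum_comm]
  simp only [hbm]
  rw [← sum_sum_perm_apply_eq i, ← Finset.sum_filter_add_sum_filter_not Finset.univ
    (fun m : Fin n => (m : ℕ) < k), sum_lt_eq_sum_castLE hkn]
  simp only [Finset.sum_ite, Finset.sum_add_distrib, Finset.sum_const, nsmul_eq_mul,
    Finset.card_univ, Fintype.card_fin]
  simp only [Finset.sum_const, nsmul_eq_mul, mul_one] at hcount
  rw [hcount, mul_add, Finset.mul_sum]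

theorem sum_perm_prod_sub_update (hkn : k ≤ n) (f : Fin n → Fin k → ℝ) (g : Fin k → ℝ)
    (i : Fin n) :
    (∑ π : Equiv.Perm (Fin n), ∏ a, f (π (Fin.castLE hkn a)) a) -
        ∑ π : Equiv.Perm (Fin n), ∏ a, Function.update f i g (π (Fin.castLE hkn a)) a =
      ∑ b, ∑ π : Equiv.Perm (Fin n) with π (Fin.castLE hkn b) = i,
        (∏ a ∈ Finset.univ.erase b, f (π (Fin.castLE hkn a)) a) * (f i b - g b) := by
  rw [← Finset.sum_sub_distrib, ← sum_sum_perm_apply_eq i,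
    ← Finset.sum_filter_add_sum_filter_not Finset.univ (fun m : Fin n => (m : ℕ) < k),
    sum_lt_eq_sum_castLE hkn, Finset.sum_eq_zero (s := Finset.univ.filter _), add_zero]
  · refine Finset.sum_congr rfl fun b _ => Finset.sum_congr rfl fun π hπ => ?_
    have hπ := (Finset.mem_filter.1 hπ).2
    have h := prod_update_eq hkn f (f i) hπ
    rw [Function.update_eq_self] at h
    rw [h, prod_update_eq hkn f g hπ, mul_sub]
  · intro m hm
    have hm : ¬ (m : ℕ) < k := (Finset.mem_filter.1 hm).2
    refine Finset.sum_eq_zero fun π hπ => sub_eq_zero.2 (Finset.prod_congr rfl fun a _ => ?_)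
    rw [update_perm_of_ne (Finset.mem_filter.1 hπ).2 fun h => hm (by rw [← h]; exact a.2)]

/-- Exchanging the positions `b` and `c` of a set `A` of positions that carry the same law: a
score `Z` read off at the position of `i` may be replaced by its average over `A`. -/
theorem sum_perm_eq_sum_perm_average (hkn : k ≤ n) (A : Finset (Fin k)) (i : Fin n)
    (F : Equiv.Perm (Fin n) → Fin k → ℝ)
    (hF : ∀ π, ∀ b ∈ A, ∀ c ∈ A, ∀ a,
      F (π * Equiv.swap (Fin.castLE hkn b) (Fin.castLE hkn c)) a = F π a) :
    ∑ b ∈ A, ∑ π : Equiv.Perm (Fin n) with π (Fin.castLE hkn b) = i, F π b =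
      ∑ b ∈ A, ∑ π : Equiv.Perm (Fin n) with π (Fin.castLE hkn b) = i,
        (A.card : ℝ)⁻¹ * ∑ c ∈ A, F π c := by
  rcases A.eq_empty_or_nonempty with rfl | hA
  · simp
  have hcard : (A.card : ℝ) ≠ 0 := by exact_mod_cast hA.card_pos.ne'
  have hbc : ∀ b ∈ A, ∀ c ∈ A, ∑ π : Equiv.Perm (Fin n) with π (Fin.castLE hkn b) = i, F π c =
      ∑ π : Equiv.Perm (Fin n) with π (Fin.castLE hkn c) = i, F π c := by
    intro b hb c hc
    refine Finset.sum_equiv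
      (Equiv.mulRight (Equiv.swap (Fin.castLE hkn b) (Fin.castLE hkn c))) ?_ ?_
    · intro π; simp
    · intro π _; exact (hF π b hb c hc c).symm
  have hinner : ∀ b ∈ A, ∑ π : Equiv.Perm (Fin n) with π (Fin.castLE hkn b) = i,
      (A.card : ℝ)⁻¹ * ∑ c ∈ A, F π c = (A.card : ℝ)⁻¹ *
        ∑ c ∈ A, ∑ π : Equiv.Perm (Fin n) with π (Fin.castLE hkn c) = i, F π c := by
    intro b hb
    rw [← Finset.mul_sum, Finset.sum_comm]
    congr 1
    exact Finset.sum_congr rfl fun c hc => hbc b hb c hc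
  rw [Finset.sum_congr rfl hinner, Finset.sum_const, nsmul_eq_mul, ← mul_assoc,
    mul_inv_cancel₀ hcard, one_mul]

end PermSum

/-! ### Likelihood ratios and clones -/

section LDP

variable {X Y : Type*}

theorem IsLDP.toReal_le {ε₀ : ℝ} {R : X → PMF Y} (hR : IsLDP ε₀ R) (x x' : X) (y : Y) :
    (R x y).toReal ≤ Real.exp ε₀ * (R x' y).toReal := by
  have h := hR x x' {y}
  rw [PMF.toOuterMeasure_apply_singleton, PMF.toOuterMeasure_apply_singleton] at h
  have h2 := ENNReal.toReal_mono
    (ENNReal.mul_ne_top ENNReal.ofReal_ne_top ((R x').apply_ne_top y)) h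
  rwa [ENNReal.toReal_mul, ENNReal.toReal_ofReal (Real.exp_nonneg _)] at h2

/-- If `r ≥ θ q`, then `r` is a mixture of `q` with weight `θ` and of some other law. -/
theorem exists_mixture_eq (r q : PMF Y) {θ : ℝ} (hθ1 : θ ≤ 1)
    (h : ∀ y, θ * (q y).toReal ≤ (r y).toReal) :
    ∃ s : PMF Y, ∀ y, (r y).toReal = θ * (q y).toReal + (1 - θ) * (s y).toReal := by
  rcases eq_or_lt_of_le hθ1 with rfl | hlt
  · refine ⟨q, fun y => ?_⟩
    -- two laws with `q ≤ r` coincide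
    have hs := r.hasSum_toReal.sub q.hasSum_toReal
    rw [sub_self] at hs
    have h0 := (hasSum_zero_iff_of_nonneg fun y => by
      have := h y; simp only [one_mul] at this; simpa using this).1 hs
    have := congrFun h0 y
    simp only [Pi.zero_apply] at this
    linarith
  have hpos : 0 < 1 - θ := by linarith
  set f : Y → ℝ := fun y => ((r y).toReal - θ * (q y).toReal) / (1 - θ) with hf
  have hf0 : ∀ y, 0 ≤ f y := fun y => div_nonneg (by linarith [h y]) hpos.le
  have hsum : HasSum f 1 := by
    have := (r.hasSum_toReal.sub (q.hasSum_toReal.mul_left θ)).div_const (1 - θ)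
    rwa [mul_one, div_self hpos.ne'] at this
  refine ⟨⟨fun y => ENNReal.ofReal (f y), ?_⟩, fun y => ?_⟩
  · rw [ENNReal.summable.hasSum_iff, ← ENNReal.ofReal_tsum_of_nonneg hf0 hsum.summable,
      hsum.tsum_eq, ENNReal.ofReal_one]
  · change _ = θ * (q y).toReal + (1 - θ) * (ENNReal.ofReal (f y)).toReal
    rw [ENNReal.toReal_ofReal (hf0 y), hf]
    field_simp
    ring

/-- The relative difference `(p - p') / q` of two laws with respect to a third one. It is only used
where `q = 0` forces `p = p' = 0`, so the value `0` it has there is harmless. -/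
noncomputable def relDiff (p p' q : PMF Y) (y : Y) : ℝ :=
  ((p y).toReal - (p' y).toReal) / (q y).toReal

variable {p p' q : PMF Y} {a : ℝ}

theorem mul_relDiff (hp : ∀ y, (p y).toReal ≤ a * (q y).toReal)
    (hp' : ∀ y, (p' y).toReal ≤ a * (q y).toReal) (y : Y) :
    (q y).toReal * relDiff p p' q y = (p y).toReal - (p' y).toReal := by
  rcases eq_or_ne (q y).toReal 0 with h0 | h0
  · have h1 := hp y
    have h2 := hp' y
    rw [h0, mul_zero] at h1 h2
    rw [h0, zero_mul, le_antisymm h1 ENNReal.toReal_nonneg, le_antisymm h2 ENNReal.toReal_nonneg,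
      sub_zero]
  · rw [relDiff]; field_simp

theorem tsum_mul_relDiff (hp : ∀ y, (p y).toReal ≤ a * (q y).toReal)
    (hp' : ∀ y, (p' y).toReal ≤ a * (q y).toReal) :
    ∑' y, (q y).toReal * relDiff p p' q y = 0 := by
  simp only [mul_relDiff hp hp']
  rw [(p.hasSum_toReal.sub p'.hasSum_toReal).tsum_eq, sub_self]

theorem abs_relDiff_le (ha : 1 ≤ a) (hp : ∀ y, (p y).toReal ≤ a * (q y).toReal)
    (hp' : ∀ y, (p' y).toReal ≤ a * (q y).toReal) (hq : ∀ y, (q y).toReal ≤ a * (p y).toReal)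
    (hq' : ∀ y, (q y).toReal ≤ a * (p' y).toReal) (y : Y) :
    |relDiff p p' q y| ≤ a - a⁻¹ := by
  have ha0 : 0 < a := by linarith
  have hinv : a⁻¹ ≤ a := (inv_le_one_of_one_le₀ ha).trans ha
  rcases eq_or_lt_of_le (ENNReal.toReal_nonneg (a := q y)) with h0 | h0
  · rw [relDiff, ← h0, div_zero, abs_zero]; linarith
  have h1 : a⁻¹ * (q y).toReal ≤ (p y).toReal := by
    rw [inv_mul_le_iff₀ ha0]; exact hq y
  have h2 : a⁻¹ * (q y).toReal ≤ (p' y).toReal := by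
    rw [inv_mul_le_iff₀ ha0]; exact hq' y
  rw [relDiff, abs_div, abs_of_pos h0, div_le_iff₀ h0, abs_le]
  constructor <;> linarith [hp y, hp' y]

/-- The variance of `p / q` under `q` is at most `a + a⁻¹ - 2` when `a⁻¹ ≤ p / q ≤ a`; the factor
`4` comes from `(u - v) ^ 2 ≤ 2 (u - 1) ^ 2 + 2 (v - 1) ^ 2`. -/
theorem tsum_mul_relDiff_sq_le (ha : 1 ≤ a) (hp : ∀ y, (p y).toReal ≤ a * (q y).toReal)
    (hp' : ∀ y, (p' y).toReal ≤ a * (q y).toReal) (hq : ∀ y, (q y).toReal ≤ a * (p y).toReal)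
    (hq' : ∀ y, (q y).toReal ≤ a * (p' y).toReal) :
    ∑' y, (q y).toReal * relDiff p p' q y ^ 2 ≤ 4 * ((a - 1) ^ 2 / a) := by
  have ha0 : 0 < a := by linarith
  have hd : (a - 1) ^ 2 / a = a + a⁻¹ - 2 := by field_simp; ring
  have key : ∀ u v : ℝ, 0 < v → u ≤ a * v → v ≤ a * u →
      v * (u / v - 1) ^ 2 ≤ (a + a⁻¹ - 2) * u := by
    intro u v hv h1 h2
    have h3 : 0 ≤ u / v - a⁻¹ := by
      rw [sub_nonneg, le_div_iff₀ hv, inv_mul_le_iff₀ ha0]; exact h2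
    have h4 : 0 ≤ a - u / v := by rw [sub_nonneg, div_le_iff₀ hv]; exact h1
    have h5 := mul_nonneg hv.le (mul_nonneg h3 h4)
    have h6 : v * (u / v) = u := by field_simp
    have h7 : a⁻¹ * a = 1 := inv_mul_cancel₀ ha0.ne'
    have h8 : v * ((u / v - a⁻¹) * (a - u / v)) =
        (a + a⁻¹) * (v * (u / v)) - v * (u / v) ^ 2 - v * (a⁻¹ * a) := by ring
    have h9 : v * (u / v - 1) ^ 2 = v * (u / v) ^ 2 - 2 * (v * (u / v)) + v := by ring
    rw [h8, h6, h7] at h5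
    rw [h9, h6]
    linarith
  have hpt : ∀ y, (q y).toReal * relDiff p p' q y ^ 2 ≤
      2 * ((a - 1) ^ 2 / a) * ((p y).toReal + (p' y).toReal) := by
    intro y
    rcases eq_or_lt_of_le (ENNReal.toReal_nonneg (a := q y)) with h0 | h0
    · rw [← h0, zero_mul]; positivity
    have e1 := key _ _ h0 (hp y) (hq y)
    have e2 := key _ _ h0 (hp' y) (hq' y)
    have e3 : relDiff p p' q y ^ 2 ≤
        2 * ((p y).toReal / (q y).toReal - 1) ^ 2 + 2 * ((p' y).toReal / (q y).toReal - 1) ^ 2 := by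
      rw [relDiff, sub_div]
      nlinarith [sq_nonneg ((p y).toReal / (q y).toReal - 1 + ((p' y).toReal / (q y).toReal - 1))]
    have e4 := mul_le_mul_of_nonneg_left e3 h0.le
    rw [hd]
    linarith
  have hsum := (p.hasSum_toReal.add p'.hasSum_toReal).mul_left (2 * ((a - 1) ^ 2 / a))
  have hs : Summable fun y => (q y).toReal * relDiff p p' q y ^ 2 :=
    Summable.of_nonneg_of_le (fun y => by positivity) hpt hsum.summable
  refine (hs.tsum_le_tsum hpt hsum.summable).trans (le_of_eq ?_)
  rw [hsum.tsum_eq]; ring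

end LDP

section Clones

variable {X Y : Type*} {n k : ℕ}

/-- The law of a message of the special slot: with probability `k / n` it comes from the
differing user, whose data is `x'`, and otherwise from a uniformly random user among those that `π`
places outside the first `k` positions. -/
noncomputable def refLaw [NeZero n] (R : X → PMF Y) (k : ℕ) (D : Fin n → X) (x' : X)
    (π : Equiv.Perm (Fin n)) : PMF Y :=
  (PMF.uniformOfFintype (Fin n)).bind fun m => R (if (m : ℕ) < k then x' else D (π m))

theorem refLaw_apply_toReal [NeZero n] (R : X → PMF Y) (k : ℕ) (D : Fin n → X) (x' : X)
    (π : Equiv.Perm (Fin n)) (y : Y) :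
    (refLaw R k D x' π y).toReal =
      (n : ℝ)⁻¹ * ∑ m : Fin n, (R (if (m : ℕ) < k then x' else D (π m)) y).toReal := by
  rw [refLaw, PMF.bind_apply, tsum_fintype]
  simp only [PMF.uniformOfFintype_apply, ← Finset.mul_sum]
  rw [ENNReal.toReal_mul, ENNReal.toReal_sum fun m _ => PMF.apply_ne_top _ _]
  simp

theorem refLaw_mul_swap [NeZero n] (R : X → PMF Y) (hkn : k ≤ n) (D : Fin n → X) (x' : X)
    (π : Equiv.Perm (Fin n)) (b c : Fin k) :
    refLaw R k D x' (π * Equiv.swap (Fin.castLE hkn b) (Fin.castLE hkn c)) =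
      refLaw R k D x' π := by
  unfold refLaw
  congr 1
  ext1 m
  split_ifs with hm
  · rfl
  · rw [Equiv.Perm.mul_apply, Equiv.swap_apply_of_ne_of_ne]
    · rintro rfl; exact hm b.2
    · rintro rfl; exact hm c.2

theorem refLaw_bounds [NeZero n] {R : X → PMF Y} {a : ℝ}
    (hR : ∀ x x' y, (R x y).toReal ≤ a * (R x' y).toReal) (k : ℕ) (D : Fin n → X) (x' : X)
    (π : Equiv.Perm (Fin n)) (x : X) (y : Y) :
    (R x y).toReal ≤ a * (refLaw R k D x' π y).toReal ∧
      (refLaw R k D x' π y).toReal ≤ a * (R x y).toReal := by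
  have hn : (0 : ℝ) < n := by exact_mod_cast NeZero.pos n
  rw [refLaw_apply_toReal]
  constructor
  · have h := Finset.sum_le_sum fun m (_ : m ∈ (Finset.univ : Finset (Fin n))) =>
      hR x (if (m : ℕ) < k then x' else D (π m)) y
    rw [Finset.sum_const, Finset.card_univ, Fintype.card_fin, nsmul_eq_mul,
      ← Finset.mul_sum] at h
    rw [mul_left_comm, le_inv_mul_iff₀ hn]
    exact h
  · have h := Finset.sum_le_sum fun m (_ : m ∈ (Finset.univ : Finset (Fin n))) =>
      hR (if (m : ℕ) < k then x' else D (π m)) x y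
    rw [Finset.sum_const, Finset.card_univ, Fintype.card_fin, nsmul_eq_mul] at h
    rw [inv_mul_le_iff₀ hn]
    exact h

/-- The law of `k` independent messages of which those in `A` have law `q` and the others have
laws `s`. -/
noncomputable def cloneLaw (q : PMF Y) (s : Fin k → PMF Y) (A : Finset (Fin k)) :
    PMF (Fin k → Y) :=
  indepPMF fun a => if a ∈ A then q else s a

/-- The probability that `A` is the set of messages with law `q`, given that a fixed element of `A`
has this law and that every other message has it with probability `θ`, independently. It is only
used for nonempty `A`, where `A.card - 1` is not truncated. -/
noncomputable def cloneWeight (k : ℕ) (θ : ℝ) (A : Finset (Fin k)) : ℝ :=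
  θ ^ (A.card - 1) * (1 - θ) ^ (k - A.card)

theorem cloneWeight_nonneg {θ : ℝ} (h0 : 0 ≤ θ) (h1 : θ ≤ 1) (A : Finset (Fin k)) :
    0 ≤ cloneWeight k θ A :=
  mul_nonneg (pow_nonneg h0 _) (pow_nonneg (by linarith) _)

theorem cloneWeight_insert {θ : ℝ} {b : Fin k} {C : Finset (Fin k)}
    (hC : C ∈ (Finset.univ.erase b).powerset) :
    cloneWeight k θ (insert b C) =
      θ ^ C.card * (1 - θ) ^ ((Finset.univ.erase b).card - C.card) := by
  rw [cloneWeight, Finset.card_insert_of_notMem (notMem_of_mem_powerset_erase hC),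
    Nat.add_sub_cancel, Finset.card_erase_of_mem (Finset.mem_univ b), Finset.card_univ,
    Fintype.card_fin, Nat.sub_sub, add_comm 1]

/-- Expanding a product of two-component mixtures over the set of messages that take the first
component. -/
theorem prod_erase_mul_eq_sum_cloneLaw {r s : Fin k → PMF Y} {q : PMF Y} {θ : ℝ}
    (h : ∀ a y, (r a y).toReal = θ * (q y).toReal + (1 - θ) * (s a y).toReal) (b : Fin k)
    (z : Fin k → Y) :
    (∏ a ∈ Finset.univ.erase b, (r a (z a)).toReal) * (q (z b)).toReal =
      ∑ A : Finset (Fin k) with b ∈ A, cloneWeight k θ A * (cloneLaw q s A z).toReal := by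
  rw [← sum_powerset_erase_insert b
    (fun A => cloneWeight k θ A * (cloneLaw q s A z).toReal)]
  simp only [h]
  rw [Finset.prod_add, Finset.sum_mul]
  refine Finset.sum_congr rfl fun C hC => ?_
  have hb := notMem_of_mem_powerset_erase hC
  have hlaw : (cloneLaw q s (insert b C) z).toReal =
      ((q (z b)).toReal * ∏ a ∈ C, (q (z a)).toReal) *
        ∏ a ∈ Finset.univ.erase b \ C, (s a (z a)).toReal := by
    have hval : cloneLaw q s (insert b C) z =
        ∏ a, (if a ∈ insert b C then q else s a) (z a) := rfl
    rw [hval, ENNReal.toReal_prod, ← Finset.prod_insert (f := fun a => (q (z a)).toReal) hb,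
      ← Finset.prod_mul_prod_compl (insert b C)]
    congr 1
    · exact Finset.prod_congr rfl fun a ha => by rw [if_pos ha]
    · have hset : (insert b C)ᶜ = Finset.univ.erase b \ C := by
        ext a; simp
      rw [← hset]
      exact Finset.prod_congr rfl fun a ha => by rw [if_neg (Finset.mem_compl.1 ha)]
  rw [hlaw, cloneWeight_insert hC, Finset.prod_mul_distrib, Finset.prod_mul_distrib,
    Finset.prod_const, Finset.prod_const,
    Finset.card_sdiff_of_subset (Finset.mem_powerset.1 hC)]
  ring

/-- Averaging over the number of clones: with probability at most `exp (-(k - 1) / (8 a))` there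
are fewer clones than the floor `κ` of half their mean. -/
theorem sum_cloneWeight_mul_le {a : ℝ} (ha : 1 ≤ a) (b : Fin k) {κ : ℤ}
    (hκ : (κ : ℝ) ≤ ((k : ℝ) - 1) / (2 * a)) {T H : ℝ} (hT : 0 ≤ T) (hH : 0 ≤ H) :
    ∑ A : Finset (Fin k) with b ∈ A,
        cloneWeight k a⁻¹ A * (if (A.card : ℝ) < κ + 1 then T else H) ≤
      H + T * Real.exp (-(((k : ℝ) - 1) / (8 * a))) := by
  have ha0 : 0 < a := by linarith
  have h0 : 0 ≤ a⁻¹ := by positivity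
  have h1 : a⁻¹ ≤ 1 := inv_le_one_of_one_le₀ ha
  have hθ : 0 ≤ 1 - a⁻¹ := by linarith
  have hcard : ((Finset.univ.erase b).card : ℝ) = (k : ℝ) - 1 := by
    rw [Finset.card_erase_of_mem (Finset.mem_univ b), Finset.card_univ, Fintype.card_fin,
      Nat.cast_sub (Fin.pos b), Nat.cast_one]
  set s := (Finset.univ : Finset (Fin k)).erase b with hs
  have hchern := sum_powerset_card_le_half_mean (s := s) h0 h1
  have htot := Finset.sum_pow_mul_eq_add_pow a⁻¹ (1 - a⁻¹) s
  rw [add_sub_cancel, one_pow] at htot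
  rw [← sum_powerset_erase_insert b
    (fun A => cloneWeight k a⁻¹ A * (if (A.card : ℝ) < κ + 1 then T else H)), ← hs]
  calc ∑ C ∈ s.powerset, cloneWeight k a⁻¹ (insert b C) *
        (if ((insert b C).card : ℝ) < κ + 1 then T else H)
      ≤ ∑ C ∈ s.powerset, (H * (a⁻¹ ^ C.card * (1 - a⁻¹) ^ (s.card - C.card)) +
          T * (if (C.card : ℝ) ≤ s.card * a⁻¹ / 2 then
            a⁻¹ ^ C.card * (1 - a⁻¹) ^ (s.card - C.card) else 0)) := by
        refine Finset.sum_le_sum fun C hC => ?_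
        rw [cloneWeight_insert hC, ← hs,
          Finset.card_insert_of_notMem (notMem_of_mem_powerset_erase hC)]
        set u := a⁻¹ ^ C.card * (1 - a⁻¹) ^ (s.card - C.card)
        have hu : 0 ≤ u := by positivity
        split_ifs with h2 h3
        · nlinarith [mul_nonneg hH hu]
        · refine absurd ?_ h3
          push_cast at h2
          rw [hcard]
          calc (C.card : ℝ) ≤ κ := by linarith
            _ ≤ _ := hκ
            _ = _ := by field_simp
        · nlinarith [mul_nonneg hT hu]
        · linarith
    _ = H + T * ∑ C ∈ s.powerset with (C.card : ℝ) ≤ s.card * a⁻¹ / 2,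
          a⁻¹ ^ C.card * (1 - a⁻¹) ^ (s.card - C.card) := by
        rw [Finset.sum_add_distrib, ← Finset.mul_sum, ← Finset.mul_sum, htot, mul_one,
          Finset.sum_filter]
    _ ≤ _ := by
        have he : -(s.card * a⁻¹ / 8) = -(((k : ℝ) - 1) / (8 * a)) := by
          rw [hcard]; field_simp
        rw [← he]
        gcongr

end Clones

/-! ### The mechanism as a mixture of clone laws -/

section Coupling

variable {X Y : Type*} {n k : ℕ}

/-- The triples `(b, A, π)` in which the permutation `π` puts user `i` at position `b`, and `A` is
a set of positions containing `b`. -/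
def cloneIndex (hkn : k ≤ n) (i : Fin n) :
    Finset (Fin k × Finset (Fin k) × Equiv.Perm (Fin n)) :=
  Finset.univ.filter fun ω => ω.1 ∈ ω.2.1 ∧ ω.2.2 (Fin.castLE hkn ω.1) = i

theorem sum_cloneIndex (hkn : k ≤ n) (i : Fin n)
    (F : Fin k × Finset (Fin k) × Equiv.Perm (Fin n) → ℝ) :
    ∑ ω ∈ cloneIndex hkn i, F ω =
      ∑ b, ∑ π : Equiv.Perm (Fin n) with π (Fin.castLE hkn b) = i,
        ∑ A : Finset (Fin k) with b ∈ A, F (b, A, π) := by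
  rw [cloneIndex, Finset.sum_filter, Fintype.sum_prod_type]
  refine Finset.sum_congr rfl fun b _ => ?_
  rw [Fintype.sum_prod_type, Finset.sum_comm, Finset.sum_filter]
  refine Finset.sum_congr rfl fun π _ => ?_
  rw [Finset.sum_filter]
  split_ifs with h <;> simp [h]

theorem sum_cloneIndex' (hkn : k ≤ n) (i : Fin n)
    (F : Fin k × Finset (Fin k) × Equiv.Perm (Fin n) → ℝ) :
    ∑ ω ∈ cloneIndex hkn i, F ω =
      ∑ A : Finset (Fin k), ∑ b ∈ A,
        ∑ π : Equiv.Perm (Fin n) with π (Fin.castLE hkn b) = i, F (b, A, π) := by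
  rw [sum_cloneIndex]
  rw [Finset.sum_congr rfl fun b _ => Finset.sum_comm]
  exact Finset.sum_comm' (by simp)

variable [NeZero n] (R : X → PMF Y) (D : Fin n → X) (x' : X) (clone : PMF Y → X → PMF Y)

/-- The law of the `k` output messages, given that slot `ω` is drawn: the messages at the positions
in `A` have the reference law, and the others have the residual laws of their users. -/
noncomputable def slotLaw (hkn : k ≤ n) (ω : Fin k × Finset (Fin k) × Equiv.Perm (Fin n)) :
    PMF (Fin k → Y) :=
  cloneLaw (refLaw R k D x' ω.2.2)
    (fun a => clone (refLaw R k D x' ω.2.2) (D (ω.2.2 (Fin.castLE hkn a)))) ω.2.1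

/-- The average over the positions in `A` of the relative difference between the laws of the
message of user `i` on the two datasets. -/
noncomputable def slotScore (i : Fin n) (ω : Fin k × Finset (Fin k) × Equiv.Perm (Fin n)) :
    (Fin k → Y) → ℝ :=
  avgOn ω.2.1 (relDiff (R (D i)) (R x') (refLaw R k D x' ω.2.2))

/-- The probability of slot `ω`. There are `k (n - 1)! = n! k / n` pairs `(b, π)`. -/
noncomputable def slotWeight (n : ℕ) {k : ℕ} (θ : ℝ)
    (ω : Fin k × Finset (Fin k) × Equiv.Perm (Fin n)) : ℝ :=
  ((n.factorial : ℝ) * (k / n))⁻¹ * cloneWeight k θ ω.2.1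

variable {R D x' clone} {θ : ℝ}

theorem subsampledShuffle_update_eq_sum (hk : 1 ≤ k) (hkn : k ≤ n) (i : Fin n)
    (hclone : ∀ π x y, (R x y).toReal = θ * (refLaw R k D x' π y).toReal +
      (1 - θ) * (clone (refLaw R k D x' π) x y).toReal) (z : Fin k → Y) :
    (subsampledShuffle R hkn (Function.update D i x') z).toReal =
      ∑ ω ∈ cloneIndex hkn i, slotWeight n θ ω * (slotLaw R D x' clone hkn ω z).toReal := by
  have hn : (0 : ℝ) < n := by exact_mod_cast NeZero.pos n
  have hk' : (0 : ℝ) < k := by exact_mod_cast hk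
  have h := card_mul_sum_perm_prod_update hkn (fun j a => (R (D j) (z a)).toReal)
    (fun a => (R x' (z a)).toReal) i
  have hupd : ∀ j a, Function.update (fun j a => (R (D j) (z a)).toReal) i
      (fun a => (R x' (z a)).toReal) j a = (R (Function.update D i x' j) (z a)).toReal := by
    intro j a
    rcases eq_or_ne j i with rfl | hj
    · simp
    · simp [hj]
  simp only [hupd] at h
  have hterm : ∀ (b : Fin k) (π : Equiv.Perm (Fin n)),
      (∏ a ∈ Finset.univ.erase b, (R (D (π (Fin.castLE hkn a))) (z a)).toReal) *
        ∑ m : Fin n, (if (m : ℕ) < k then (R x' (z b)).toReal else (R (D (π m)) (z b)).toReal) =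
      n * ∑ A : Finset (Fin k) with b ∈ A,
        cloneWeight k θ A * (slotLaw R D x' clone hkn (b, A, π) z).toReal := by
    intro b π
    have e := prod_erase_mul_eq_sum_cloneLaw
      (fun a y => hclone π (D (π (Fin.castLE hkn a))) y) b z
    unfold slotLaw
    rw [← e, refLaw_apply_toReal]
    have : ∀ m : Fin n, (R (if (m : ℕ) < k then x' else D (π m)) (z b)).toReal =
        if (m : ℕ) < k then (R x' (z b)).toReal else (R (D (π m)) (z b)).toReal := fun m => by
      split_ifs <;> rfl
    simp only [this]
    field_simp
  simp only [hterm, ← Finset.mul_sum] at h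
  rw [subsampledShuffle_apply_toReal, sum_cloneIndex]
  simp only [slotWeight, mul_assoc, ← Finset.mul_sum]
  have hfac : (n.factorial : ℝ) ≠ 0 := by exact_mod_cast n.factorial_ne_zero
  field_simp
  linarith

theorem subsampledShuffle_sub_update_eq_sum {a : ℝ} (hk : 1 ≤ k) (hkn : k ≤ n) (i : Fin n)
    (hR : ∀ x x' y, (R x y).toReal ≤ a * (R x' y).toReal)
    (hclone : ∀ π x y, (R x y).toReal = θ * (refLaw R k D x' π y).toReal +
      (1 - θ) * (clone (refLaw R k D x' π) x y).toReal) (z : Fin k → Y) :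
    (subsampledShuffle R hkn D z).toReal -
        (subsampledShuffle R hkn (Function.update D i x') z).toReal =
      (k / n : ℝ) * ∑ ω ∈ cloneIndex hkn i, slotWeight n θ ω *
        ((slotLaw R D x' clone hkn ω z).toReal * slotScore R D x' i ω z) := by
  have hn : (0 : ℝ) < n := by exact_mod_cast NeZero.pos n
  have hk' : (0 : ℝ) < k := by exact_mod_cast hk
  set Z : Equiv.Perm (Fin n) → Y → ℝ :=
    fun π => relDiff (R (D i)) (R x') (refLaw R k D x' π) with hZ
  have h := sum_perm_prod_sub_update hkn (fun j a => (R (D j) (z a)).toReal)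
    (fun a => (R x' (z a)).toReal) i
  have hupd : ∀ j a, Function.update (fun j a => (R (D j) (z a)).toReal) i
      (fun a => (R x' (z a)).toReal) j a = (R (Function.update D i x' j) (z a)).toReal := by
    intro j a
    rcases eq_or_ne j i with rfl | hj
    · simp
    · simp [hj]
  simp only [hupd] at h
  have hterm : ∀ (b : Fin k) (π : Equiv.Perm (Fin n)),
      (∏ a ∈ Finset.univ.erase b, (R (D (π (Fin.castLE hkn a))) (z a)).toReal) *
        ((R (D i) (z b)).toReal - (R x' (z b)).toReal) =
      ∑ A : Finset (Fin k) with b ∈ A, cloneWeight k θ A *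
        ((slotLaw R D x' clone hkn (b, A, π) z).toReal * Z π (z b)) := by
    intro b π
    have e := prod_erase_mul_eq_sum_cloneLaw
      (fun a y => hclone π (D (π (Fin.castLE hkn a))) y) b z
    rw [← mul_relDiff (fun y => (refLaw_bounds hR k D x' π (D i) y).1)
      (fun y => (refLaw_bounds hR k D x' π x' y).1) (z b), ← mul_assoc, e, Finset.sum_mul]
    refine Finset.sum_congr rfl fun A _ => ?_
    rw [mul_assoc]; rfl
  simp only [hterm] at h
  have hswap : ∀ A : Finset (Fin k), ∑ b ∈ A,
      ∑ π : Equiv.Perm (Fin n) with π (Fin.castLE hkn b) = i,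
        cloneWeight k θ A * ((slotLaw R D x' clone hkn (b, A, π) z).toReal * Z π (z b)) =
      ∑ b ∈ A, ∑ π : Equiv.Perm (Fin n) with π (Fin.castLE hkn b) = i,
        cloneWeight k θ A * ((slotLaw R D x' clone hkn (b, A, π) z).toReal *
          slotScore R D x' i (b, A, π) z) := by
    intro A
    -- the exchanged positions both lie in `A`, so the reference law and the messages outside `A`
    -- are unaffected
    have hF := sum_perm_eq_sum_perm_average hkn A i
      (fun π c => cloneWeight k θ A *
        ((cloneLaw (refLaw R k D x' π)
          (fun a => clone (refLaw R k D x' π) (D (π (Fin.castLE hkn a)))) A z).toReal *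
            Z π (z c))) ?_
    · refine hF.trans (Finset.sum_congr rfl fun b _ => Finset.sum_congr rfl fun π _ => ?_)
      simp only [slotLaw, slotScore, avgOn, ← Finset.mul_sum]
      ring
    · intro π b hb c hc a
      have hlaw : cloneLaw (refLaw R k D x' π) (fun a => clone (refLaw R k D x' π)
          (D ((π * Equiv.swap (Fin.castLE hkn b) (Fin.castLE hkn c)) (Fin.castLE hkn a)))) A =
          cloneLaw (refLaw R k D x' π)
            (fun a => clone (refLaw R k D x' π) (D (π (Fin.castLE hkn a)))) A := by
        unfold cloneLaw
        congr 1
        ext1 a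
        split_ifs with ha
        · rfl
        · beta_reduce
          rw [Equiv.Perm.mul_apply, Equiv.swap_apply_of_ne_of_ne]
          · exact fun h => ha (Fin.castLE_injective hkn h ▸ hb)
          · exact fun h => ha (Fin.castLE_injective hkn h ▸ hc)
      simp only [hZ, refLaw_mul_swap, hlaw]
  rw [← sum_cloneIndex hkn i fun ω => cloneWeight k θ ω.2.1 *
    ((slotLaw R D x' clone hkn ω z).toReal * Z ω.2.2 (z ω.1)), sum_cloneIndex',
    Finset.sum_congr rfl fun A _ => hswap A,
    ← sum_cloneIndex' hkn i fun ω => cloneWeight k θ ω.2.1 *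
    ((slotLaw R D x' clone hkn ω z).toReal * slotScore R D x' i ω z)] at h
  rw [subsampledShuffle_apply_toReal, subsampledShuffle_apply_toReal, ← mul_sub, h]
  simp only [slotWeight, mul_assoc, ← Finset.mul_sum]
  have hfac : (n.factorial : ℝ) ≠ 0 := by exact_mod_cast n.factorial_ne_zero
  field_simp

theorem sum_slotWeight_mul_le {a : ℝ} (ha : 1 ≤ a) (hk : 1 ≤ k) (hkn : k ≤ n) (i : Fin n) {κ : ℤ}
    (hκ : (κ : ℝ) ≤ ((k : ℝ) - 1) / (2 * a)) {T H : ℝ} (hT : 0 ≤ T) (hH : 0 ≤ H) :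
    ∑ ω ∈ cloneIndex hkn i, slotWeight n a⁻¹ ω * (if (ω.2.1.card : ℝ) < κ + 1 then T else H) ≤
      H + T * Real.exp (-(((k : ℝ) - 1) / (8 * a))) := by
  have hn : (0 : ℝ) < n := by exact_mod_cast NeZero.pos n
  have hk' : (0 : ℝ) < k := by exact_mod_cast hk
  have hfac : (0 : ℝ) < n.factorial := by exact_mod_cast n.factorial_pos
  set U := H + T * Real.exp (-(((k : ℝ) - 1) / (8 * a))) with hU
  -- the number of pairs `(b, π)` with `π b = i`
  have hcount : ∑ b : Fin k, ∑ π : Equiv.Perm (Fin n) with π (Fin.castLE hkn b) = i, (1 : ℝ) =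
      n.factorial * (k / n) := by
    have h := card_mul_sum_perm_prod_update hkn (fun _ _ => 1) (fun _ => 1) i
    have hone : Function.update (fun (_ : Fin n) (_ : Fin k) => (1 : ℝ)) i (fun _ => 1) =
      fun _ _ => 1 := Function.update_eq_self i _
    simp only [hone, Finset.prod_const_one, ite_self, one_mul] at h
    simp only [Finset.sum_const, Finset.card_univ, Fintype.card_fin, Fintype.card_perm,
      nsmul_eq_mul, mul_one, ← Finset.sum_mul] at h ⊢
    field_simp
    linarith
  rw [sum_cloneIndex]
  simp only [slotWeight, mul_assoc, ← Finset.mul_sum]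
  rw [inv_mul_le_iff₀ (by positivity), ← hcount, Finset.sum_mul]
  refine Finset.sum_le_sum fun b _ => ?_
  rw [Finset.sum_mul]
  refine Finset.sum_le_sum fun π _ => ?_
  rw [one_mul]
  exact sum_cloneWeight_mul_le ha b hκ hT hH

/-- The Rényi sum of the subsampled shuffle mechanism on a pair of neighboring datasets, for a
randomizer with likelihood ratios at most `a`. The `j`-th absolute moment of the score is bounded
by its Gaussian-type bound `H j` if there are at least `κ` clones, and by `(a - a⁻¹) ^ j`
otherwise. -/
theorem tsum_subsampledShuffle_le [Countable Y] {a : ℝ} (ha : 1 ≤ a) (hk : 1 ≤ k) (hkn : k ≤ n)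
    (hR : ∀ x x' y, (R x y).toReal ≤ a * (R x' y).toReal) (D : Fin n → X) (i : Fin n) (x' : X)
    {κ : ℤ} (hκ0 : 0 ≤ κ) (hκ : (κ : ℝ) ≤ ((k : ℝ) - 1) / (2 * a)) {m : ℕ} (hm : 2 ≤ m)
    {H : ℕ → ℝ} (hH2 : H 2 = 4 * ((a - 1) ^ 2 / a) / (κ + 1))
    (hH : ∀ j, 3 ≤ j → H j = j * Real.Gamma ((j : ℝ) / 2) *
      (2 * (a - a⁻¹) ^ 2 / (κ + 1)) ^ ((j : ℝ) / 2)) :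
    ∑' z, subsampledShuffle R hkn D z ^ (m : ℝ) *
        subsampledShuffle R hkn (Function.update D i x') z ^ (1 - (m : ℝ)) ≤
      ENNReal.ofReal (1 + ∑ j ∈ Finset.Icc 2 m, (m.choose j : ℝ) * (k / n : ℝ) ^ j *
        (H j + (a - a⁻¹) ^ j * Real.exp (-(((k : ℝ) - 1) / (8 * a))))) := by
  have ha0 : 0 < a := by linarith
  have h0 : 0 ≤ a⁻¹ := by positivity
  have h1 : a⁻¹ ≤ 1 := inv_le_one_of_one_le₀ ha
  have hB : 0 ≤ a - a⁻¹ := by linarith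
  have hκ1 : (0 : ℝ) < κ + 1 := by
    have : (0 : ℝ) ≤ κ := by exact_mod_cast hκ0
    linarith
  have hHnn : ∀ j, 2 ≤ j → 0 ≤ H j := by
    intro j hj
    rcases eq_or_lt_of_le hj with rfl | hj
    · rw [hH2]; positivity
    · rw [hH j hj]
      have := Real.Gamma_pos_of_pos (show (0 : ℝ) < (j : ℝ) / 2 by positivity)
      positivity
  -- every randomizer output law is a mixture of the reference law and a residual law
  have hex : ∀ q : PMF Y, ∃ s : X → PMF Y,
      (∀ x y, a⁻¹ * (q y).toReal ≤ (R x y).toReal) →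
      ∀ x y, (R x y).toReal = a⁻¹ * (q y).toReal + (1 - a⁻¹) * (s x y).toReal := by
    intro q
    by_cases hq : ∀ x y, a⁻¹ * (q y).toReal ≤ (R x y).toReal
    · choose s hs using fun x => exists_mixture_eq (R x) q h1 (hq x)
      exact ⟨s, fun _ => hs⟩
    · exact ⟨fun _ => q, fun h => absurd h hq⟩
  choose clone hclone' using hex
  have hclone : ∀ π x y, (R x y).toReal = a⁻¹ * (refLaw R k D x' π y).toReal +
      (1 - a⁻¹) * (clone (refLaw R k D x' π) x y).toReal := fun π =>
    hclone' _ fun x y => by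
      rw [inv_mul_le_iff₀ ha0]; exact (refLaw_bounds hR k D x' π x y).2
  have hw : ∀ ω ∈ cloneIndex hkn i, 0 ≤ slotWeight n a⁻¹ ω := fun ω _ =>
    mul_nonneg (by positivity) (cloneWeight_nonneg h0 h1 _)
  have hZ : ∀ π y, |relDiff (R (D i)) (R x') (refLaw R k D x' π) y| ≤ a - a⁻¹ := fun π =>
    abs_relDiff_le ha (fun y => (refLaw_bounds hR k D x' π _ y).1)
      (fun y => (refLaw_bounds hR k D x' π _ y).1) (fun y => (refLaw_bounds hR k D x' π _ y).2)
      (fun y => (refLaw_bounds hR k D x' π _ y).2)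
  have hmean : ∀ π, ∑' y, (refLaw R k D x' π y).toReal *
      relDiff (R (D i)) (R x') (refLaw R k D x' π) y = 0 := fun π =>
    tsum_mul_relDiff (fun y => (refLaw_bounds hR k D x' π _ y).1)
      (fun y => (refLaw_bounds hR k D x' π _ y).1)
  have hV : ∀ π, ∑' y, (refLaw R k D x' π y).toReal *
      relDiff (R (D i)) (R x') (refLaw R k D x' π) y ^ 2 ≤ 4 * ((a - 1) ^ 2 / a) := fun π =>
    tsum_mul_relDiff_sq_le ha (fun y => (refLaw_bounds hR k D x' π _ y).1)
      (fun y => (refLaw_bounds hR k D x' π _ y).1) (fun y => (refLaw_bounds hR k D x' π _ y).2)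
      (fun y => (refLaw_bounds hR k D x' π _ y).2)
  refine (tsum_pow_mul_pow_one_sub_le hw (by positivity)
    (fun ω z => abs_avgOn_le hB (hZ ω.2.2) z)
    (subsampledShuffle_update_eq_sum hk hkn i hclone)
    (subsampledShuffle_sub_update_eq_sum hk hkn i hR hclone) hm).trans
    (ENNReal.ofReal_le_ofReal (add_le_add_right (Finset.sum_le_sum fun j hj => ?_) _))
  have hj2 : 2 ≤ j := (Finset.mem_Icc.1 hj).1
  refine mul_le_mul_of_nonneg_left ?_ (by positivity)
  refine le_trans (Finset.sum_le_sum fun ω hω => mul_le_mul_of_nonneg_left ?_ (hw ω hω))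
    (sum_slotWeight_mul_le ha hk hkn i hκ (pow_nonneg hB j) (hHnn j hj2))
  have hne : ω.2.1.Nonempty := ⟨ω.1, (Finset.mem_filter.1 hω).2.1⟩
  split_ifs with hlt
  · exact tsum_abs_avgOn_pow_le _ hB (hZ ω.2.2) j
  · have hr : ∀ a ∈ ω.2.1, (if a ∈ ω.2.1 then refLaw R k D x' ω.2.2 else
        clone (refLaw R k D x' ω.2.2) (D (ω.2.2 (Fin.castLE hkn a)))) = refLaw R k D x' ω.2.2 :=
      fun a ha => if_pos ha
    have hge : (κ : ℝ) + 1 ≤ ω.2.1.card := not_lt.1 hlt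
    rcases eq_or_lt_of_le hj2 with rfl | hj3
    · refine (tsum_abs_avgOn_sq_le hr hne (hZ ω.2.2) (hmean ω.2.2) (hV ω.2.2)).trans ?_
      rw [hH2]
      gcongr
    · refine (tsum_abs_avgOn_pow_le_gamma hr hne (hZ ω.2.2) (hmean ω.2.2) (by omega)).trans ?_
      rw [hH j hj3]
      have := Real.Gamma_pos_of_pos (show (0 : ℝ) < (j : ℝ) / 2 by positivity)
      gcongr

end Coupling

/-! ### The Rényi privacy bound -/

theorem theorem1 {X Y : Type*} [Countable Y] (n k : ℕ) (hk1 : 1 ≤ k) (hkn : k ≤ n)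
    (ε₀ : ℝ) (hε₀ : 0 ≤ ε₀) (R : X → PMF Y) (hR : IsLDP ε₀ R)
    (lam : ℕ) (hlam : 2 ≤ lam)
    (γ kbar Υ : ℝ)
    (hγ : γ = (k : ℝ) / (n : ℝ))
    (hkbar : kbar = (⌊((k : ℝ) - 1) / (2 * Real.exp ε₀)⌋ : ℝ) + 1)
    (hΥ : Υ = ((1 + γ * ((Real.exp (2 * ε₀) - 1) / Real.exp ε₀)) ^ lam - 1
        - (lam : ℝ) * γ * ((Real.exp (2 * ε₀) - 1) / Real.exp ε₀))
      * Real.exp (-(((k : ℝ) - 1) / (8 * Real.exp ε₀)))) :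
    rdp (subsampledShuffle R hkn) (lam : ℝ) ≤
      ((1 / ((lam : ℝ) - 1) * Real.log
        (1 + 4 * (lam.choose 2 : ℝ) * γ ^ 2
              * ((Real.exp ε₀ - 1) ^ 2 / (kbar * Real.exp ε₀))
          + ∑ j ∈ Finset.Icc 3 lam, (lam.choose j : ℝ) * γ ^ j * (j : ℝ)
              * Real.Gamma ((j : ℝ) / 2)
              * (2 * (Real.exp (2 * ε₀) - 1) ^ 2 / (kbar * Real.exp (2 * ε₀))) ^ ((j : ℝ) / 2)
          + Υ) : ℝ) : EReal) := by
  have : NeZero n := ⟨by omega⟩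
  set a := Real.exp ε₀ with ha_def
  have ha : 1 ≤ a := Real.one_le_exp hε₀
  have ha0 : 0 < a := by linarith
  have ha2 : Real.exp (2 * ε₀) = a ^ 2 := by rw [mul_comm, Real.exp_mul]; norm_cast
  set κ := ⌊((k : ℝ) - 1) / (2 * a)⌋ with hκ_def
  have hk1' : (1 : ℝ) ≤ k := by exact_mod_cast hk1
  have hκ0 : 0 ≤ κ := Int.floor_nonneg.2 (div_nonneg (by linarith) (by linarith))
  have hκ1 : (0 : ℝ) < kbar := by
    have : (0 : ℝ) ≤ κ := by exact_mod_cast hκ0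
    rw [hkbar]; linarith
  have hB : (a ^ 2 - 1) / a = a - a⁻¹ := by field_simp
  have hinv : a⁻¹ ≤ a := (inv_le_one_of_one_le₀ ha).trans ha
  set τ := Real.exp (-(((k : ℝ) - 1) / (8 * a))) with hτ
  rw [ha2]
  rw [ha2, hB] at hΥ
  set H : ℕ → ℝ := fun j => if j = 2 then 4 * ((a - 1) ^ 2 / a) / kbar else
    j * Real.Gamma ((j : ℝ) / 2) * (2 * (a - a⁻¹) ^ 2 / kbar) ^ ((j : ℝ) / 2) with hH
  have hIcc : Finset.Icc 2 lam = insert 2 (Finset.Icc 3 lam) := by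
    ext j; simp only [Finset.mem_Icc, Finset.mem_insert]; omega
  -- the binomial expansion behind `Υ`
  have hbinom : ∑ j ∈ Finset.Icc 2 lam, (lam.choose j : ℝ) * γ ^ j * (a - a⁻¹) ^ j =
      (1 + γ * (a - a⁻¹)) ^ lam - 1 - lam * γ * (a - a⁻¹) := by
    have hrange : Finset.range (lam + 1) = insert 0 (insert 1 (Finset.Icc 2 lam)) := by
      ext j; simp only [Finset.mem_range, Finset.mem_insert, Finset.mem_Icc]; omega
    rw [add_comm 1, add_pow, hrange, Finset.sum_insert (by simp), Finset.sum_insert (by simp)]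
    simp only [one_pow, mul_one, pow_zero, pow_one, Nat.choose_zero_right, Nat.choose_one_right,
      Nat.cast_one]
    have : ∑ j ∈ Finset.Icc 2 lam, (lam.choose j : ℝ) * γ ^ j * (a - a⁻¹) ^ j =
        ∑ j ∈ Finset.Icc 2 lam, (γ * (a - a⁻¹)) ^ j * lam.choose j :=
      Finset.sum_congr rfl fun j _ => by rw [mul_pow]; ring
    rw [this]
    ring
  have hrhs : 1 + 4 * (lam.choose 2 : ℝ) * γ ^ 2 * ((a - 1) ^ 2 / (kbar * a))
        + ∑ j ∈ Finset.Icc 3 lam, (lam.choose j : ℝ) * γ ^ j * (j : ℝ) * Real.Gamma ((j : ℝ) / 2)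
            * (2 * (a ^ 2 - 1) ^ 2 / (kbar * a ^ 2)) ^ ((j : ℝ) / 2) + Υ =
      1 + ∑ j ∈ Finset.Icc 2 lam, (lam.choose j : ℝ) * γ ^ j *
        (H j + (a - a⁻¹) ^ j * τ) := by
    have hsplit : ∑ j ∈ Finset.Icc 2 lam, (lam.choose j : ℝ) * γ ^ j *
        (H j + (a - a⁻¹) ^ j * τ) =
        ∑ j ∈ Finset.Icc 2 lam, (lam.choose j : ℝ) * γ ^ j * H j + Υ := by
      rw [hΥ, ← hbinom, Finset.sum_mul, ← Finset.sum_add_distrib]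
      exact Finset.sum_congr rfl fun j _ => by ring
    rw [hsplit, hIcc, Finset.sum_insert (by simp), ← add_assoc, ← add_assoc]
    congr 2
    · congr 1
      simp only [hH, if_true]
      field_simp
    · refine Finset.sum_congr rfl fun j hj => ?_
      have hj : j ≠ 2 := by have := (Finset.mem_Icc.1 hj).1; omega
      have hbase : 2 * (a ^ 2 - 1) ^ 2 / (kbar * a ^ 2) = 2 * (a - a⁻¹) ^ 2 / kbar := by
        rw [← hB]; field_simp
      simp only [hH, if_neg hj]
      rw [hbase]
      ring
  have hsum0 : 0 ≤ ∑ j ∈ Finset.Icc 2 lam, (lam.choose j : ℝ) * γ ^ j *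
      (H j + (a - a⁻¹) ^ j * τ) := by
    refine Finset.sum_nonneg fun j hj => ?_
    have hj : 2 ≤ j := (Finset.mem_Icc.1 hj).1
    have hγ0 : 0 ≤ γ := by rw [hγ]; positivity
    have hB0 : 0 ≤ a - a⁻¹ := by linarith
    have hG := Real.Gamma_pos_of_pos (show (0 : ℝ) < (j : ℝ) / 2 by positivity)
    have hHj : 0 ≤ H j := by
      simp only [hH]; split_ifs <;> positivity
    positivity
  rw [hrhs]
  have hlam1 : (0 : ℝ) ≤ ((lam : ℝ) - 1)⁻¹ := by
    have : (2 : ℝ) ≤ lam := by exact_mod_cast hlam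
    exact inv_nonneg.2 (by linarith)
  refine iSup_le fun D => iSup_le fun D' => iSup_le fun hD => ?_
  obtain ⟨i, hi⟩ := hD
  have hD' : D' = Function.update D i (D' i) := by
    ext1 j
    rcases eq_or_ne j i with rfl | hj
    · simp
    · rw [Function.update_of_ne hj, hi j hj]
  have key := tsum_subsampledShuffle_le ha hk1 hkn hR.toReal_le D i (D' i) hκ0
    (Int.floor_le _) hlam (H := H) (by simp [hH, hkbar])
    (fun j hj => by
      have hj : j ≠ 2 := by omega
      simp only [hH, if_neg hj, hkbar])
  rw [← hD', ← hγ] at key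
  rw [renyiDiv, one_div, EReal.coe_mul, ← ENNReal.log_ofReal_of_pos (by linarith)]
  exact mul_le_mul_of_nonneg_left (ENNReal.log_le_log key) (EReal.coe_nonneg.2 hlam1)
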